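/- For $z\in\mathbb{C}\setminus(-\infty,1]$ and $\nu,\mu\in\mathbb{C}$ let $$P_\nu^\mu(z)=\left(\frac{z+1}{z-1}\right)^{\mu/2}\,\frac{1}{\Gamma(1-\mu)}\,{}_2F_1\!\left(-\nu,\nu+1;1-\mu;\frac{1-z}{2}\right)$$ be the associated Legendre function of the first kind (Hobson's normalisation), where $\frac{1}{\Gamma(c)}{}_2F_1(a,b;c;w)$ denotes the principal branch on $\mathbb{C}\setminus[1,\infty)$ of the regularized Gauss function $\sum_{k\ge 0}\frac{(a)_k(b)_k}{\Gamma(c+k)\,k!}w^k$ (defined for all $a,b,c\in\mathbb{C}$). All powers and logarithms of $z\pm1$ are taken with $-\pi<\arg(z\pm1)<\pi$; in particular $\ln\frac{z^2-1}{4}=\ln\frac{z-1}{2}+\ln\frac{z+1}{2}$, $\left(\frac{z^2-1}{4}\right)^{s}=\left(\frac{z-1}{2}\right)^{s}\left(\frac{z+1}{2}\right)^{s}$ and $\arg\frac{z+1}{z-1}=\arg(z+1)-\arg(z-1)$. Let $\psi=\Gamma'/\Gamma$. Let $m,n$ be integers with $0\le m\le n$ and let $z\in\mathbb{C}\setminus(-\infty,1]$.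 Then $\nu\mapsto P_\nu^m(z)$ is (complex) differentiable at $\nu=n$, $\mu\mapsto P_n^\mu(z)$ is (complex) differentiable at $\mu=m$, and $$\begin{aligned} \frac{\partial P_\nu^m(z)}{\partial\nu}\bigg|_{\nu=n}-\frac{\partial P_n^\mu(z)}{\partial\mu}\bigg|_{\mu=m} ={}&\frac12P_n^m(z)\ln\frac{z^2-1}{4}-2\psi(n-m+1)P_n^m(z)\\ &-(-1)^m\frac{(n+m)!}{(n-m)!}\left(\frac{z^2-1}{4}\right)^{-m/2}\sum_{k=0}^{m-1}(-1)^k\frac{(k+n-m)!\,(m-k-1)!}{k!\,(n+m-k)!}\left(\frac{z-1}{2}\right)^k\\ &+\frac{(n+m)!}{(n-m)!}\left(\frac{z-1}{z+1}\right)^{m/2}\sum_{k=0}^{n}\frac{(k+n)!}{k!\,(k+m)!\,(n-k)!}\,[2\psi(k+n+1)-\psi(k+1)]\left(\frac{z-1}{2}\right)^k \end{aligned}$$ and also $$\begin{aligned} \frac{\partial P_\nu^m(z)}{\partial\nu}\bigg|_{\nu=n}-\frac{\partial P_n^\mu(z)}{\partial\mu}\bigg|_{\mu=m} ={}&\frac12P_n^m(z)\ln\frac{z^2-1}{4}-2\psi(n-m+1)P_n^m(z)\\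 &-(-1)^n\frac{(n+m)!}{(n-m)!}\left(\frac{z^2-1}{4}\right)^{-m/2}\sum_{k=0}^{m-1}\frac{(k+n-m)!\,(m-k-1)!}{k!\,(n+m-k)!}\left(\frac{z+1}{2}\right)^k\\ &+(-1)^n\frac{(n+m)!}{(n-m)!}\left(\frac{z+1}{z-1}\right)^{m/2}\sum_{k=0}^{n}(-1)^k\frac{(k+n)!}{k!\,(k+m)!\,(n-k)!}\,[2\psi(k+n+1)-\psi(k+1)]\left(\frac{z+1}{2}\right)^k, \end{aligned}$$ where for $m=0$ the sums $\sum_{k=0}^{m-1}$ are empty and equal to $0$. -/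

import Mathlib

/-! The associated Legendre function of the first kind (Hobson's normalisation, cut along `(-∞, 1]`)
for arbitrary complex degree and order. -/

namespace HobsonLegendre

/-- The hypergeometric cut plane `ℂ ∖ [1, ∞)`. -/
def hgPlane : Set ℂ := {w | 1 - w ∈ Complex.slitPlane}

/-- `f` is the principal branch of the regularized Gauss function
`w ↦ ₂F₁(a, b; c; w) / Γ(c)`: it is analytic on `ℂ ∖ [1, ∞)` and agrees with the
regularized Gauss series `∑ (a)ₖ (b)ₖ wᵏ / (Γ(c + k) k!)` on the open unit disc. -/
def IsPrincipalGauss (a b c : ℂ) (f : ℂ → ℂ) : Prop :=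
  AnalyticOnNhd ℂ f hgPlane ∧
    ∀ w : ℂ, ‖w‖ < 1 → f w = Complex.regularizedGaussHGFun a b c w

theorem isPreconnected_hgPlane : IsPreconnected hgPlane := by
  have h : hgPlane = (fun w : ℂ => 1 - w) '' Complex.slitPlane := by
    ext w
    constructor
    · intro hw
      exact ⟨1 - w, hw, by simp⟩
    · rintro ⟨v, hv, rfl⟩
      simpa [hgPlane] using hv
  rw [h]
  have hc : IsPathConnected Complex.slitPlane :=
    Complex.starConvex_one_slitPlane.isPathConnected Complex.one_mem_slitPlane
  exact hc.isConnected.isPreconnected.image _ (by fun_prop)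

/-- The principal branch is unique on the cut plane. -/
theorem IsPrincipalGauss.eqOn {a b c : ℂ} {f g : ℂ → ℂ} (hf : IsPrincipalGauss a b c f)
    (hg : IsPrincipalGauss a b c g) : Set.EqOn f g hgPlane := by
  have h0 : (0 : ℂ) ∈ hgPlane := by simp [hgPlane]
  refine hf.1.eqOn_of_preconnected_of_eventuallyEq hg.1 isPreconnected_hgPlane h0 ?_
  filter_upwards [Metric.ball_mem_nhds (0 : ℂ) one_pos] with w hw
  have hw' : ‖w‖ < 1 := by simpa using hw
  rw [hf.2 w hw', hg.2 w hw']

open Classical in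
/-- The principal branch of `w ↦ ₂F₁(a, b; c; w) / Γ(c)` on `ℂ ∖ [1, ∞)`, that is, the analytic
continuation of the regularized Gauss series (which exists for all `a b c`). -/
noncomputable def gaussReg (a b c : ℂ) : ℂ → ℂ :=
  if h : ∃ f : ℂ → ℂ, IsPrincipalGauss a b c f then h.choose else 0

theorem gaussReg_eqOn {a b c : ℂ} {f : ℂ → ℂ} (hf : IsPrincipalGauss a b c f) :
    Set.EqOn (gaussReg a b c) f hgPlane := by
  have h : ∃ f : ℂ → ℂ, IsPrincipalGauss a b c f := ⟨f, hf⟩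
  unfold gaussReg
  rw [dif_pos h]
  exact h.choose_spec.eqOn hf

/-- The associated Legendre function of the first kind `P_ν^μ(z)`, `z ∈ ℂ ∖ (-∞, 1]`:
`((z + 1) / (z - 1)) ^ (μ / 2) · ₂F₁(-ν, ν + 1; 1 - μ; (1 - z) / 2) / Γ(1 - μ)`.
On this domain the principal argument of `(z + 1) / (z - 1)` is `arg (z + 1) - arg (z - 1)`. -/
noncomputable def legendreP (ν μ z : ℂ) : ℂ :=
  ((z + 1) / (z - 1)) ^ (μ / 2) * gaussReg (-ν) (ν + 1) (1 - μ) ((1 - z) / 2)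

/-- `ln ((z² - 1) / 4)` with the phase `arg (z - 1) + arg (z + 1)`, both arguments in `(-π, π)`. -/
noncomputable def logQuarter (z : ℂ) : ℂ :=
  Complex.log ((z - 1) / 2) + Complex.log ((z + 1) / 2)

/-- `((z² - 1) / 4) ^ s` with the same phase. -/
noncomputable def powQuarter (z s : ℂ) : ℂ :=
  ((z - 1) / 2) ^ s * ((z + 1) / 2) ^ s

end HobsonLegendre

/-! By joint holomorphy in `(ν, μ)`, the difference of the two partial derivatives is the derivative
at `ε = 0` of `P_{n+ε}^{m-ε}(z)`. Along this line the Gauss parameters satisfy `c - b = -(n + m)`,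
so Euler's transformation (`isPrincipalGauss_euler_transform`) turns the Gauss function into `((z +
1) / 2) ^ (ε - m)` times a polynomial in `w = (1 - z) / 2`. The product rule finishes: the two
powers contribute half of `logQuarter z`. Coefficients with `k < m` contain `1 / Γ` at one of its
zeros, so only its derivative survives; the remaining coefficients produce the digamma values.

The second formula is the first one reflected. The polynomial has `a + b + 1 = 2 c`, so its
differential equation is invariant under `w ↦ 1 - w` and it is even or odd about `w = 1/2`. This
parity holds for all small `ε` and hence passes to the `ε`-derivative (`psiPoly_one_sub`).

The analytic input is that `gaussReg` exists and is holomorphic in its parameters when `Re b > 0`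
(`differentiableAt_gaussReg`). Euler's integral gives this for `Re c > Re b > 0`, and a contiguous
relation then lowers `c` step by step. -/

namespace HobsonLegendre

open Complex

/-! ### The regularized Gauss series -/

/-- The `k`-th coefficient of the regularized Gauss series. -/
noncomputable def gaussCoeff (a b c : ℂ) (k : ℕ) : ℂ :=
  (ascPochhammer ℂ k).eval a * (ascPochhammer ℂ k).eval b * (Gamma (c + k))⁻¹ / k.factorial

theorem hasSum_gaussCoeff (a b c : ℂ) {w : ℂ} (hw : ‖w‖ < 1) :
    HasSum (fun k : ℕ => gaussCoeff a b c k * w ^ k) (regularizedGaussHGFun a b c w) := by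
  have hr : w ∈ Metric.eball (0 : ℂ) (regularizedGaussHGFunSeries a b c).radius := by
    refine Metric.eball_subset_eball (radius_regularizedGaussHGFunSeries_ge_one a b c) ?_
    rw [← ENNReal.ofReal_one, Metric.eball_ofReal]
    simpa using hw
  refine ((regularizedGaussHGFunSeries a b c).hasSum hr).congr_fun ?_
  intro k
  rw [FormalMultilinearSeries.apply_eq_pow_smul_coeff, coeff_regularizedGaussHGFunSeries,
    gaussCoeff, smul_eq_mul, mul_comm (w ^ k)]
  field_simp

theorem isPrincipalGauss_of_hasSum {a b c : ℂ} {f : ℂ → ℂ} (hf : AnalyticOnNhd ℂ f hgPlane)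
    (h : ∀ w : ℂ, ‖w‖ < 1 → HasSum (fun k : ℕ => gaussCoeff a b c k * w ^ k) (f w)) :
    IsPrincipalGauss a b c f :=
  ⟨hf, fun w hw => (h w hw).unique (hasSum_gaussCoeff a b c hw)⟩

theorem IsPrincipalGauss.hasSum {a b c : ℂ} {f : ℂ → ℂ} (h : IsPrincipalGauss a b c f) {w : ℂ}
    (hw : ‖w‖ < 1) : HasSum (fun k : ℕ => gaussCoeff a b c k * w ^ k) (f w) := by
  rw [h.2 w hw]
  exact hasSum_gaussCoeff a b c hw

theorem IsPrincipalGauss.isPrincipalGauss_gaussReg {a b c : ℂ} {f : ℂ → ℂ}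
    (h : IsPrincipalGauss a b c f) : IsPrincipalGauss a b c (gaussReg a b c) := by
  have h' : ∃ f : ℂ → ℂ, IsPrincipalGauss a b c f := ⟨f, h⟩
  unfold gaussReg
  rw [dif_pos h']
  exact h'.choose_spec

theorem isOpen_hgPlane : IsOpen hgPlane :=
  isOpen_slitPlane.preimage (by fun_prop)

theorem mem_hgPlane_of_norm_lt_one {w : ℂ} (hw : ‖w‖ < 1) : w ∈ hgPlane := by
  have := mem_slitPlane_of_norm_lt_one (z := -w) (by simpa using hw)
  simpa [hgPlane, sub_eq_add_neg] using this

theorem one_sub_ne_zero_of_mem_hgPlane {w : ℂ} (hw : w ∈ hgPlane) : 1 - w ≠ 0 :=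
  slitPlane_ne_zero hw

/-- Without division by `c + k` the recursion holds for every `c`, because `1 / Γ(s) = s / Γ(s + 1)`
is valid even at the poles of `Γ`. -/
theorem gaussCoeff_succ_mul (a b c : ℂ) (k : ℕ) :
    (k + 1) * (c + k) * gaussCoeff a b c (k + 1) = (a + k) * (b + k) * gaussCoeff a b c k := by
  have hG := one_div_Gamma_eq_self_mul_one_div_Gamma_add_one (c + k)
  have hk : ((k : ℂ) + 1) ≠ 0 := Nat.cast_add_one_ne_zero k
  have hf : (k.factorial : ℂ) ≠ 0 := Nat.cast_ne_zero.2 k.factorial_ne_zero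
  simp only [gaussCoeff, ascPochhammer_succ_eval, Nat.factorial_succ]
  push_cast
  rw [hG, show c + ((k : ℂ) + 1) = c + k + 1 by ring]
  field_simp

theorem hasSum_mul_shift {u : ℕ → ℂ} {w s : ℂ} (h : HasSum (fun k => u k * w ^ k) s) :
    HasSum (fun k => (Nat.casesOn k 0 u : ℂ) * w ^ k) (w * s) := by
  rw [← hasSum_nat_add_iff' 1]
  simpa [pow_succ, mul_comm, mul_left_comm, mul_assoc] using h.mul_left w

theorem gaussCoeff_sub_one_zero (a b c : ℂ) :
    gaussCoeff a b (c - 1) 0 = (c - 1) * gaussCoeff a b c 0 := by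
  have hG := one_div_Gamma_eq_self_mul_one_div_Gamma_add_one (c - 1)
  rw [sub_add_cancel] at hG
  simp [gaussCoeff, hG]

/-- Expressing each reciprocal Gamma value through `1 / Γ(c + k + 1)` leaves a polynomial identity.
It is the coefficient form of `(1 - w) F(c - 1) = (c - 1 - (2c - a - b - 1) w) F(c) + (c - a)(c - b)
w F(c + 1)`. -/
theorem gaussCoeff_contiguous (a b c : ℂ) (k : ℕ) :
    gaussCoeff a b (c - 1) (k + 1) - gaussCoeff a b (c - 1) k
      = (c - 1) * gaussCoeff a b c (k + 1) - (2 * c - a - b - 1) * gaussCoeff a b c k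
        + (c - a) * (c - b) * gaussCoeff a b (c + 1) k := by
  have h1 := one_div_Gamma_eq_self_mul_one_div_Gamma_add_one (c + k)
  have h2 := one_div_Gamma_eq_self_mul_one_div_Gamma_add_one (c + k - 1)
  rw [sub_add_cancel] at h2
  have hk : ((k : ℂ) + 1) ≠ 0 := Nat.cast_add_one_ne_zero k
  have hf : (k.factorial : ℂ) ≠ 0 := Nat.cast_ne_zero.2 k.factorial_ne_zero
  simp only [gaussCoeff, ascPochhammer_succ_eval, Nat.factorial_succ]
  push_cast
  rw [show c - 1 + ((k : ℂ) + 1) = c + k by ring, show c - 1 + (k : ℂ) = c + k - 1 by ring,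
    show c + ((k : ℂ) + 1) = c + k + 1 by ring, show c + 1 + (k : ℂ) = c + k + 1 by ring, h2, h1]
  field_simp
  ring

/-- The contiguous relation lowering the third parameter. -/
theorem IsPrincipalGauss.sub_one {a b c : ℂ} {f g : ℂ → ℂ} (hf : IsPrincipalGauss a b c f)
    (hg : IsPrincipalGauss a b (c + 1) g) :
    IsPrincipalGauss a b (c - 1) (fun w => ((c - 1 - (2 * c - a - b - 1) * w) * f w
      + (c - a) * (c - b) * w * g w) / (1 - w)) := by
  refine ⟨?_, fun w hw => ?_⟩
  · intro w hw
    have h1 := hf.1 w hw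
    have h2 := hg.1 w hw
    have h3 := one_sub_ne_zero_of_mem_hgPlane hw
    fun_prop (disch := assumption)
  · have hF := hf.hasSum hw
    have hG := hg.hasSum hw
    have hH := hasSum_gaussCoeff a b (c - 1) hw
    rw [div_eq_iff (one_sub_ne_zero_of_mem_hgPlane (mem_hgPlane_of_norm_lt_one hw))]
    have h1 := (((hF.mul_left (c - 1)).sub ((hasSum_mul_shift hF).mul_left (2 * c - a - b - 1))).add
      ((hasSum_mul_shift hG).mul_left ((c - a) * (c - b))))
    have h2 := hH.sub (hasSum_mul_shift hH)
    have h3 := h1.unique (h2.congr_fun fun k => ?_)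
    · linear_combination h3
    · cases k with
      | zero => simp [gaussCoeff_sub_one_zero]
      | succ k =>
        simp only
        linear_combination (-w ^ (k + 1)) * gaussCoeff_contiguous a b c k

/-- The binomial series, with coefficients written as Pochhammer symbols. -/
theorem hasSum_one_sub_cpow_neg (a : ℂ) {w : ℂ} (hw : ‖w‖ < 1) :
    HasSum (fun k : ℕ => (ascPochhammer ℂ k).eval a / k.factorial * w ^ k) ((1 - w) ^ (-a)) := by
  have h := (one_div_one_sub_cpow_hasFPowerSeriesOnBall_zero a).hasSum (y := w) (by
    rw [← ENNReal.ofReal_one, Metric.eball_ofReal]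
    simpa using hw)
  rw [zero_add, one_div, ← cpow_neg] at h
  refine h.congr_fun fun k => ?_
  have hk : Ring.choose (a + k - 1) k = (ascPochhammer ℂ k).eval a / k.factorial := by
    rw [eq_div_iff (Nat.cast_ne_zero.2 k.factorial_ne_zero), ← Ring.multichoose_eq,
      ← Polynomial.ascPochhammer_smeval_eq_eval, ← Ring.factorial_nsmul_multichoose_eq_ascPochhammer,
      nsmul_eq_mul, mul_comm]
  rw [FormalMultilinearSeries.apply_eq_pow_smul_coeff, FormalMultilinearSeries.coeff_ofScalars,
    hk, smul_eq_mul, mul_comm]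

/-- The slit plane is star-shaped about `1`; hence Euler's integrand never meets the branch cut. -/
theorem one_sub_mul_mem_slitPlane {w : ℂ} (hw : w ∈ hgPlane) {t : ℝ} (ht : t ∈ Set.Icc (0 : ℝ) 1) :
    1 - w * t ∈ slitPlane := by
  have := starConvex_one_slitPlane hw (sub_nonneg.2 ht.2) ht.1 (sub_add_cancel 1 t)
  convert this using 1
  simp only [real_smul, ofReal_sub, ofReal_one]
  ring

end HobsonLegendre

namespace HobsonLegendre

open Complex MeasureTheory Set Filter Topology

/-! ### Euler's integral -/

/-- The integrand of Euler's integral. -/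
noncomputable def eulerIntegrand (a b c w : ℂ) (t : ℝ) : ℂ :=
  (t : ℂ) ^ (b - 1) * (1 - (t : ℂ)) ^ (c - b - 1) * (1 - w * t) ^ (-a)

/-- Euler's integral, without its Gamma factors. -/
noncomputable def eulerIntegral (a b c w : ℂ) : ℂ :=
  ∫ t in Ioo (0 : ℝ) 1, eulerIntegrand a b c w t

theorem integrableOn_beta {u v : ℂ} (hu : 0 < u.re) (hv : 0 < v.re) :
    IntegrableOn (fun t : ℝ => (t : ℂ) ^ (u - 1) * (1 - (t : ℂ)) ^ (v - 1)) (Ioo 0 1) := by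
  have := betaIntegral_convergent hu hv
  rwa [intervalIntegrable_iff_integrableOn_Ioo_of_le zero_le_one] at this

theorem setIntegral_beta {u v : ℂ} (hu : 0 < u.re) (hv : 0 < v.re) :
    ∫ t in Ioo (0 : ℝ) 1, (t : ℂ) ^ (u - 1) * (1 - (t : ℂ)) ^ (v - 1)
      = Gamma u * Gamma v / Gamma (u + v) := by
  rw [← betaIntegral_eq_Gamma_mul_div u v hu hv, betaIntegral,
    intervalIntegral.integral_of_le zero_le_one, integral_Ioc_eq_integral_Ioo]

theorem norm_ofReal_cpow_of_mem {t : ℝ} (ht : t ∈ Ioo (0 : ℝ) 1) (s : ℂ) :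
    ‖(t : ℂ) ^ s‖ = t ^ s.re :=
  norm_cpow_eq_rpow_re_of_pos ht.1 s

theorem norm_one_sub_ofReal_cpow_of_mem {t : ℝ} (ht : t ∈ Ioo (0 : ℝ) 1) (s : ℂ) :
    ‖(1 - (t : ℂ)) ^ s‖ = (1 - t) ^ s.re := by
  have := norm_cpow_eq_rpow_re_of_pos (sub_pos.2 ht.2) s
  push_cast at this
  exact this

theorem integrableOn_beta_real {u v : ℝ} (hu : 0 < u) (hv : 0 < v) :
    IntegrableOn (fun t : ℝ => t ^ (u - 1) * (1 - t) ^ (v - 1)) (Ioo 0 1) := by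
  have h := (integrableOn_beta (u := u) (v := v) (by simpa) (by simpa)).norm
  refine IntegrableOn.congr_fun h (fun t ht => ?_) measurableSet_Ioo
  simp only [norm_mul]
  rw [norm_ofReal_cpow_of_mem ht, norm_one_sub_ofReal_cpow_of_mem ht]
  simp

theorem continuousOn_beta (u v : ℂ) :
    ContinuousOn (fun t : ℝ => (t : ℂ) ^ u * (1 - (t : ℂ)) ^ v) (Ioo 0 1) := by
  refine ContinuousOn.mul ?_ ?_
  · refine ContinuousOn.cpow_const (by fun_prop) fun t ht => ?_
    exact_mod_cast (ofReal_mem_slitPlane.2 ht.1)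
  · refine ContinuousOn.cpow_const (by fun_prop) fun t ht => ?_
    exact_mod_cast (ofReal_mem_slitPlane.2 (sub_pos.2 ht.2))

theorem continuousOn_eulerIntegrand (a b c : ℂ) {w : ℂ} (hw : w ∈ hgPlane) :
    ContinuousOn (eulerIntegrand a b c w) (Ioo 0 1) := by
  refine (continuousOn_beta _ _).mul (ContinuousOn.cpow_const (by fun_prop) fun t ht => ?_)
  exact one_sub_mul_mem_slitPlane hw (Ioo_subset_Icc_self ht)

theorem integrableOn_beta_mul {u v : ℂ} (hu : 0 < u.re) (hv : 0 < v.re) {f : ℝ → ℂ}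
    (hf : ContinuousOn f (Icc 0 1)) :
    IntegrableOn (fun t : ℝ => (t : ℂ) ^ (u - 1) * (1 - (t : ℂ)) ^ (v - 1) * f t) (Ioo 0 1) := by
  obtain ⟨C, hC⟩ := isCompact_Icc.exists_bound_of_continuousOn hf
  refine Integrable.mul_bdd (c := C) (integrableOn_beta hu hv)
    ((hf.mono Ioo_subset_Icc_self).aestronglyMeasurable measurableSet_Ioo) ?_
  exact (ae_restrict_mem measurableSet_Ioo).mono fun t ht => hC t (Ioo_subset_Icc_self ht)

theorem continuousOn_one_sub_mul_cpow (s : ℂ) {w : ℂ} (hw : w ∈ hgPlane) :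
    ContinuousOn (fun t : ℝ => (1 - w * t) ^ s) (Icc 0 1) :=
  ContinuousOn.cpow_const (by fun_prop) fun _ ht => one_sub_mul_mem_slitPlane hw ht

/-- Differentiation under the integral: the `w`-derivative of `(1 - w t) ^ (-a)` is bounded on a
compact ball times `[0, 1]`, so a multiple of the beta density dominates. -/
theorem analyticOnNhd_eulerIntegral {a b c : ℂ} (hb : 0 < b.re) (hcb : 0 < (c - b).re) :
    AnalyticOnNhd ℂ (eulerIntegral a b c) hgPlane := by
  refine DifferentiableOn.analyticOnNhd (fun w₀ hw₀ => ?_) isOpen_hgPlane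
  obtain ⟨δ, hδ, hball⟩ := Metric.nhds_basis_closedBall.mem_iff.1 (isOpen_hgPlane.mem_nhds hw₀)
  have hcont : ContinuousOn (fun p : ℂ × ℝ => a * p.2 * (1 - p.1 * p.2) ^ (-a - 1))
      (Metric.closedBall w₀ δ ×ˢ Icc 0 1) := by
    refine ContinuousOn.mul (by fun_prop) (ContinuousOn.cpow_const (by fun_prop) fun p hp => ?_)
    exact one_sub_mul_mem_slitPlane (hball hp.1) hp.2
  obtain ⟨C, hC⟩ := ((isCompact_closedBall w₀ δ).prod isCompact_Icc).exists_bound_of_continuousOn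
    hcont
  have hB := integrableOn_beta hb hcb
  refine (hasDerivAt_integral_of_dominated_loc_of_deriv_le
    (μ := volume.restrict (Ioo (0 : ℝ) 1)) (F := fun w t => eulerIntegrand a b c w t)
    (F' := fun w t => (t : ℂ) ^ (b - 1) * (1 - (t : ℂ)) ^ (c - b - 1)
      * (a * t * (1 - w * t) ^ (-a - 1)))
    (bound := fun t => ‖(t : ℂ) ^ (b - 1) * (1 - (t : ℂ)) ^ (c - b - 1)‖ * C)
    (Metric.closedBall_mem_nhds w₀ hδ) ?_ ?_ ?_ ?_ (hB.norm.mul_const C) ?_).2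
      |>.differentiableAt.differentiableWithinAt
  · filter_upwards [isOpen_hgPlane.mem_nhds hw₀] with w hw
    exact (continuousOn_eulerIntegrand a b c hw).aestronglyMeasurable measurableSet_Ioo
  · exact integrableOn_beta_mul hb hcb (continuousOn_one_sub_mul_cpow _ hw₀)
  · refine ((continuousOn_beta _ _).mul (ContinuousOn.mul (by fun_prop) ?_)).aestronglyMeasurable
      measurableSet_Ioo
    exact (continuousOn_one_sub_mul_cpow _ hw₀).mono Ioo_subset_Icc_self
  · refine (ae_restrict_mem measurableSet_Ioo).mono fun t ht w hw => ?_
    rw [norm_mul]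
    gcongr
    exact hC (w, t) ⟨hw, Ioo_subset_Icc_self ht⟩
  · refine (ae_restrict_mem measurableSet_Ioo).mono fun t ht w hw => ?_
    have hs := one_sub_mul_mem_slitPlane (hball hw) (Ioo_subset_Icc_self ht)
    have h1 : HasDerivAt (fun w : ℂ => 1 - w * t) (-t) w := by
      simpa using ((hasDerivAt_id w).mul_const (t : ℂ)).const_sub 1
    have h2 := (h1.cpow_const (c := -a) hs).const_mul
      ((t : ℂ) ^ (b - 1) * (1 - (t : ℂ)) ^ (c - b - 1))
    exact h2.congr_deriv (by ring)

theorem ascPochhammer_mul_Gamma {b : ℂ} (hb : 0 < b.re) (k : ℕ) :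
    (ascPochhammer ℂ k).eval b * Gamma b = Gamma (b + k) := by
  have h : ∀ j : ℕ, b ≠ -j := by
    rintro j rfl
    simp at hb
    linarith [j.cast_nonneg (α := ℝ)]
  rw [← Gamma_add_nat_div_Gamma_eq b h, div_mul_cancel₀ _ (Gamma_ne_zero h)]

/-- Expand `(1 - w t) ^ (-a)` binomially and integrate termwise; each term is a beta integral. Since
`|w t| ≤ |w|`, the absolutely convergent binomial series at `w` justifies the interchange. -/
theorem hasSum_eulerIntegral {a b c : ℂ} (hb : 0 < b.re) (hcb : 0 < (c - b).re) {w : ℂ}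
    (hw : ‖w‖ < 1) :
    HasSum (fun k : ℕ => gaussCoeff a b c k * w ^ k)
      ((Gamma b * Gamma (c - b))⁻¹ * eulerIntegral a b c w) := by
  set β : ℝ → ℂ := fun t => (t : ℂ) ^ (b - 1) * (1 - (t : ℂ)) ^ (c - b - 1) with hβ
  have hβi : IntegrableOn β (Ioo 0 1) := integrableOn_beta hb hcb
  set u : ℕ → ℂ := fun k => (ascPochhammer ℂ k).eval a / k.factorial with hu
  set F : ℕ → ℝ → ℂ := fun k t => β t * (u k * (w * t) ^ k) with hF
  have hFi : ∀ k, IntegrableOn (F k) (Ioo 0 1) := fun k =>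
    integrableOn_beta_mul hb hcb (by fun_prop)
  have hsum : Summable fun k => ∫ t in Ioo (0 : ℝ) 1, ‖F k t‖ := by
    have h := (hasSum_one_sub_cpow_neg a hw).summable.norm.mul_right (∫ t in Ioo (0 : ℝ) 1, ‖β t‖)
    refine h.of_nonneg_of_le (fun k => integral_nonneg fun t => norm_nonneg _) fun k => ?_
    rw [← integral_const_mul]
    refine setIntegral_mono_on (hFi k).norm (hβi.norm.const_mul _) measurableSet_Ioo fun t ht => ?_
    rw [hF, norm_mul, mul_comm]
    gcongr
    rw [norm_mul, norm_mul, mul_pow, norm_mul]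
    refine mul_le_mul_of_nonneg_left (mul_le_of_le_one_right (norm_nonneg _) ?_) (norm_nonneg _)
    rw [norm_pow, norm_real, Real.norm_of_nonneg ht.1.le]
    exact pow_le_one₀ ht.1.le ht.2.le
  have key := hasSum_integral_of_summable_integral_norm hFi hsum
  have hint : ∫ t in Ioo (0 : ℝ) 1, ∑' k, F k t = eulerIntegral a b c w := by
    refine setIntegral_congr_fun measurableSet_Ioo fun t ht => ?_
    have hwt : ‖w * t‖ < 1 := by
      rw [norm_mul, norm_real, Real.norm_of_nonneg ht.1.le]
      nlinarith [ht.1, ht.2, norm_nonneg w]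
    exact ((hasSum_one_sub_cpow_neg a hwt).mul_left (β t)).tsum_eq
  rw [hint] at key
  refine (key.mul_left _).congr_fun fun k => ?_
  have hbk : 0 < (b + k).re := by
    simp only [add_re, natCast_re]
    positivity
  have hval : ∫ t in Ioo (0 : ℝ) 1, F k t
      = u k * w ^ k * (Gamma (b + k) * Gamma (c - b) / Gamma (b + k + (c - b))) := by
    rw [← setIntegral_beta hbk hcb, ← integral_const_mul]
    refine setIntegral_congr_fun measurableSet_Ioo fun t ht => ?_
    have ht0 : (t : ℂ) ≠ 0 := ofReal_ne_zero.2 ht.1.ne'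
    simp only [hF, hβ]
    rw [show b + k - 1 = b - 1 + k by ring, cpow_add _ _ ht0, cpow_natCast, mul_pow]
    ring
  have hG1 : Gamma b ≠ 0 := Gamma_ne_zero_of_re_pos hb
  have hG2 : Gamma (c - b) ≠ 0 := Gamma_ne_zero_of_re_pos hcb
  rw [hval, ← ascPochhammer_mul_Gamma hb, gaussCoeff, show b + k + (c - b) = c + k by ring]
  simp only [hu]
  field_simp

theorem isPrincipalGauss_eulerIntegral {a b c : ℂ} (hb : 0 < b.re) (hcb : 0 < (c - b).re) :
    IsPrincipalGauss a b c
      (fun w => (Gamma b * Gamma (c - b))⁻¹ * eulerIntegral a b c w) :=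
  isPrincipalGauss_of_hasSum (analyticOnNhd_const.mul (analyticOnNhd_eulerIntegral hb hcb))
    fun _ hw => hasSum_eulerIntegral hb hcb hw

end HobsonLegendre

/-! ### Holomorphy of Euler's integral in its parameters -/

namespace HobsonLegendre

open Complex MeasureTheory Set Filter Topology

/-- The derivative of Euler's integrand in its three parameters. -/
noncomputable def eulerIntegrandFDeriv (w : ℂ) (p : ℂ × ℂ × ℂ) (t : ℝ) : ℂ × ℂ × ℂ →L[ℂ] ℂ :=
  eulerIntegrand p.1 p.2.1 p.2.2 w t •
    (((Real.log t : ℝ) : ℂ) • (ContinuousLinearMap.fst ℂ ℂ ℂ ∘L ContinuousLinearMap.snd ℂ ℂ (ℂ × ℂ))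
      + ((Real.log (1 - t) : ℝ) : ℂ) •
        (ContinuousLinearMap.snd ℂ ℂ ℂ ∘L ContinuousLinearMap.snd ℂ ℂ (ℂ × ℂ)
          - ContinuousLinearMap.fst ℂ ℂ ℂ ∘L ContinuousLinearMap.snd ℂ ℂ (ℂ × ℂ))
      + (-log (1 - w * t)) • ContinuousLinearMap.fst ℂ ℂ (ℂ × ℂ))

theorem hasFDerivAt_eulerIntegrand {w : ℂ} (hw : w ∈ hgPlane) {t : ℝ} (ht : t ∈ Ioo (0 : ℝ) 1)
    (p : ℂ × ℂ × ℂ) :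
    HasFDerivAt (fun p : ℂ × ℂ × ℂ => eulerIntegrand p.1 p.2.1 p.2.2 w t)
      (eulerIntegrandFDeriv w p t) p := by
  have hA : HasFDerivAt (fun p : ℂ × ℂ × ℂ => p.1) (ContinuousLinearMap.fst ℂ ℂ (ℂ × ℂ)) p :=
    hasFDerivAt_fst
  have hS : HasFDerivAt (fun p : ℂ × ℂ × ℂ => p.2) (ContinuousLinearMap.snd ℂ ℂ (ℂ × ℂ)) p :=
    hasFDerivAt_snd
  have hB := hS.fst
  have hC := hS.snd
  have h0 : (t : ℂ) ≠ 0 := ofReal_ne_zero.2 ht.1.ne'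
  have h1 : (1 - t : ℂ) ≠ 0 := by exact_mod_cast (sub_pos.2 ht.2).ne'
  have h2 : 1 - w * t ≠ 0 := slitPlane_ne_zero (one_sub_mul_mem_slitPlane hw (Ioo_subset_Icc_self ht))
  have hl : log (1 - (t : ℂ)) = ((Real.log (1 - t) : ℝ) : ℂ) := by
    rw [ofReal_log (sub_pos.2 ht.2).le]
    push_cast
    rfl
  have h := (((hB.sub_const 1).const_cpow (Or.inl h0)).mul
    (((hC.sub hB).sub_const 1).const_cpow (Or.inl h1))).mul (hA.neg.const_cpow (Or.inl h2))
  refine h.congr_fderiv (ContinuousLinearMap.ext fun v => ?_)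
  simp only [eulerIntegrandFDeriv, eulerIntegrand, hl, ← ofReal_log ht.1.le,
    _root_.add_apply, _root_.smul_apply, _root_.sub_apply,
    _root_.neg_apply, ContinuousLinearMap.comp_apply, smul_eq_mul, Pi.mul_apply,
    Pi.sub_apply, Pi.neg_apply]
  ring

/-- Real parts of at least `2 * η` leave a spare factor `t ^ η * (1 - t) ^ η`, which absorbs the
logarithms through `x ^ η * |log x| ≤ 1 / η`. What remains is an integrable majorant that does not
involve `p`. -/
theorem norm_eulerIntegrandFDeriv_le {w : ℂ} {p : ℂ × ℂ × ℂ} {t η M₁ M₂ : ℝ}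
    (ht : t ∈ Ioo (0 : ℝ) 1) (hη : 0 < η) (hb : 2 * η ≤ p.2.1.re) (hcb : 2 * η ≤ (p.2.2 - p.2.1).re)
    (h₁ : ‖log (1 - w * t)‖ ≤ M₁) (h₂ : ‖(1 - w * t) ^ (-p.1)‖ ≤ M₂) :
    ‖eulerIntegrandFDeriv w p t‖
      ≤ t ^ (η - 1) * (1 - t) ^ (η - 1) * (M₂ * (1 / η + 1 / η * 2 + M₁)) := by
  have h1t : 1 - t ∈ Ioo (0 : ℝ) 1 := ⟨sub_pos.2 ht.2, sub_lt_self _ ht.1⟩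
  have hpow : ∀ {x r : ℝ}, x ∈ Ioo (0 : ℝ) 1 → 2 * η ≤ r → x ^ (r - 1) ≤ x ^ (η - 1) * x ^ η := by
    intro x r hx hr
    rw [← Real.rpow_add hx.1]
    exact Real.rpow_le_rpow_of_exponent_ge hx.1 hx.2.le (by linarith)
  have hone : ∀ {x : ℝ}, x ∈ Ioo (0 : ℝ) 1 → x ^ η ≤ 1 := fun hx =>
    Real.rpow_le_one hx.1.le hx.2.le hη.le
  have hlog : ∀ {x : ℝ}, x ∈ Ioo (0 : ℝ) 1 → x ^ η * |Real.log x| ≤ 1 / η := by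
    intro x hx
    have := (Real.abs_log_mul_self_rpow_lt x η hx.1 hx.2.le hη).le
    rwa [abs_mul, abs_of_nonneg (Real.rpow_nonneg hx.1.le η), mul_comm] at this
  have hx := ht.1
  have hy := h1t.1
  have hM₁ : 0 ≤ M₁ := (norm_nonneg _).trans h₁
  have hM₂ : 0 ≤ M₂ := (norm_nonneg _).trans h₂
  have hE : ‖eulerIntegrand p.1 p.2.1 p.2.2 w t‖
      ≤ (t ^ (η - 1) * (1 - t) ^ (η - 1) * M₂) * (t ^ η * (1 - t) ^ η) := by
    rw [eulerIntegrand, norm_mul, norm_mul, norm_ofReal_cpow_of_mem ht,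
      norm_one_sub_ofReal_cpow_of_mem ht]
    have e1 := hpow ht (r := p.2.1.re) hb
    have e2 := hpow h1t (r := (p.2.2 - p.2.1).re) hcb
    calc _ ≤ (t ^ (η - 1) * t ^ η) * ((1 - t) ^ (η - 1) * (1 - t) ^ η) * M₂ := by
          simp only [sub_re (_ : ℂ) 1, one_re]
          gcongr
      _ = _ := by ring
  have hA := ContinuousLinearMap.norm_fst_le ℂ ℂ (ℂ × ℂ)
  have hB : ‖ContinuousLinearMap.fst ℂ ℂ ℂ ∘L ContinuousLinearMap.snd ℂ ℂ (ℂ × ℂ)‖ ≤ 1 :=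
    (ContinuousLinearMap.opNorm_comp_le _ _).trans (mul_le_one₀
      (ContinuousLinearMap.norm_fst_le ℂ ℂ ℂ) (norm_nonneg _)
      (ContinuousLinearMap.norm_snd_le ℂ ℂ (ℂ × ℂ)))
  have hC : ‖ContinuousLinearMap.snd ℂ ℂ ℂ ∘L ContinuousLinearMap.snd ℂ ℂ (ℂ × ℂ)‖ ≤ 1 :=
    (ContinuousLinearMap.opNorm_comp_le _ _).trans (mul_le_one₀
      (ContinuousLinearMap.norm_snd_le ℂ ℂ ℂ) (norm_nonneg _)
      (ContinuousLinearMap.norm_snd_le ℂ ℂ (ℂ × ℂ)))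
  have hD := (norm_sub_le (ContinuousLinearMap.snd ℂ ℂ ℂ ∘L ContinuousLinearMap.snd ℂ ℂ (ℂ × ℂ))
    (ContinuousLinearMap.fst ℂ ℂ ℂ ∘L ContinuousLinearMap.snd ℂ ℂ (ℂ × ℂ))).trans
    ((add_le_add hC hB).trans_eq one_add_one_eq_two)
  rw [eulerIntegrandFDeriv, norm_smul]
  have hrest : _ ≤ |Real.log t| * 1 + |Real.log (1 - t)| * 2 + M₁ * 1 :=
    (norm_add₃_le
      (a := ((Real.log t : ℝ) : ℂ) •
        (ContinuousLinearMap.fst ℂ ℂ ℂ ∘L ContinuousLinearMap.snd ℂ ℂ (ℂ × ℂ)))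
      (b := ((Real.log (1 - t) : ℝ) : ℂ) •
          (ContinuousLinearMap.snd ℂ ℂ ℂ ∘L ContinuousLinearMap.snd ℂ ℂ (ℂ × ℂ)
            - ContinuousLinearMap.fst ℂ ℂ ℂ ∘L ContinuousLinearMap.snd ℂ ℂ (ℂ × ℂ)))
      (c := (-log (1 - w * t)) • ContinuousLinearMap.fst ℂ ℂ (ℂ × ℂ))).trans (by
    rw [norm_smul, norm_smul, norm_smul, norm_neg, norm_real, norm_real, Real.norm_eq_abs,
      Real.norm_eq_abs]
    gcongr)
  refine (mul_le_mul hE hrest (norm_nonneg _) (by positivity)).trans ?_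
  have hl := hlog ht
  have hl' := hlog h1t
  have ho := hone ht
  have ho' := hone h1t
  calc _ = t ^ (η - 1) * (1 - t) ^ (η - 1) * (M₂ * ((t ^ η * |Real.log t|) * (1 - t) ^ η
        + t ^ η * ((1 - t) ^ η * |Real.log (1 - t)|) * 2 + (t ^ η * (1 - t) ^ η) * M₁)) := by ring
    _ ≤ t ^ (η - 1) * (1 - t) ^ (η - 1) * (M₂ * (1 / η * 1 + 1 * (1 / η) * 2 + (1 * 1) * M₁)) := by
      gcongr
    _ = _ := by ring

theorem differentiableAt_eulerIntegral {w : ℂ} (hw : w ∈ hgPlane) {p₀ : ℂ × ℂ × ℂ}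
    (hb : 0 < p₀.2.1.re) (hcb : 0 < (p₀.2.2 - p₀.2.1).re) :
    DifferentiableAt ℂ (fun p : ℂ × ℂ × ℂ => eulerIntegral p.1 p.2.1 p.2.2 w) p₀ := by
  -- On the ball of radius `η` the real part of `c - b` drops by at most `2 * η`, so the margin `4 *
  -- η` leaves the required `2 * η`.
  obtain ⟨η, hη, hηb, hηc⟩ : ∃ η : ℝ, 0 < η ∧ 4 * η ≤ p₀.2.1.re ∧ 4 * η ≤ (p₀.2.2 - p₀.2.1).re :=
    ⟨min p₀.2.1.re (p₀.2.2 - p₀.2.1).re / 4, by positivity, by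
      linarith [min_le_left p₀.2.1.re (p₀.2.2 - p₀.2.1).re], by
      linarith [min_le_right p₀.2.1.re (p₀.2.2 - p₀.2.1).re]⟩
  have hcl : ContinuousOn (fun t : ℝ => log (1 - w * t)) (Icc 0 1) :=
    ContinuousOn.clog (by fun_prop) fun t ht => one_sub_mul_mem_slitPlane hw ht
  obtain ⟨M₁, hM₁⟩ := isCompact_Icc.exists_bound_of_continuousOn hcl
  have hcp : ContinuousOn (fun q : ℂ × ℝ => (1 - w * q.2) ^ (-q.1))
      (Metric.closedBall p₀.1 η ×ˢ Icc 0 1) :=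
    ContinuousOn.cpow (by fun_prop) (by fun_prop) fun q hq => one_sub_mul_mem_slitPlane hw hq.2
  obtain ⟨M₂, hM₂⟩ := ((isCompact_closedBall p₀.1 η).prod isCompact_Icc).exists_bound_of_continuousOn
    hcp
  refine (hasFDerivAt_integral_of_dominated_of_fderiv_le
    (μ := volume.restrict (Ioo (0 : ℝ) 1))
    (F := fun (p : ℂ × ℂ × ℂ) t => eulerIntegrand p.1 p.2.1 p.2.2 w t)
    (F' := eulerIntegrandFDeriv w)
    (bound := fun t => t ^ (η - 1) * (1 - t) ^ (η - 1) * (M₂ * (1 / η + 1 / η * 2 + M₁)))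
    (Metric.closedBall_mem_nhds p₀ hη)
    (.of_forall fun p => ?_) ?_ ?_ ?_ ((integrableOn_beta_real hη hη).mul_const _) ?_).differentiableAt
  · exact (continuousOn_eulerIntegrand _ _ _ hw).aestronglyMeasurable measurableSet_Ioo
  · exact integrableOn_beta_mul hb hcb (continuousOn_one_sub_mul_cpow _ hw)
  · have hlt : ContinuousOn (fun t : ℝ => ((Real.log t : ℝ) : ℂ)) (Ioo 0 1) :=
      continuous_ofReal.comp_continuousOn
        (Real.continuousOn_log.mono fun t (ht : t ∈ Ioo (0 : ℝ) 1) => ht.1.ne')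
    have hlt' : ContinuousOn (fun t : ℝ => ((Real.log (1 - t) : ℝ) : ℂ)) (Ioo 0 1) :=
      continuous_ofReal.comp_continuousOn
        (ContinuousOn.log (by fun_prop) fun t (ht : t ∈ Ioo (0 : ℝ) 1) => (sub_pos.2 ht.2).ne')
    have hlw : ContinuousOn (fun t : ℝ => log (1 - w * t)) (Ioo 0 1) := hcl.mono Ioo_subset_Icc_self
    have hE := continuousOn_eulerIntegrand p₀.1 p₀.2.1 p₀.2.2 hw
    refine ContinuousOn.aestronglyMeasurable ?_ measurableSet_Ioo
    unfold eulerIntegrandFDeriv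
    fun_prop
  · refine (ae_restrict_mem measurableSet_Ioo).mono fun t ht p hp => ?_
    rw [Metric.mem_closedBall, dist_eq_norm] at hp
    have h1 : ‖p.1 - p₀.1‖ ≤ η := (norm_fst_le (p - p₀)).trans hp
    have h2 : ‖p.2.1 - p₀.2.1‖ ≤ η := ((norm_fst_le (p - p₀).2).trans (norm_snd_le _)).trans hp
    have h3 : ‖p.2.2 - p₀.2.2‖ ≤ η := ((norm_snd_le (p - p₀).2).trans (norm_snd_le _)).trans hp
    have h2' := (abs_le.1 ((abs_re_le_norm _).trans h2))
    have h3' := (abs_le.1 ((abs_re_le_norm _).trans h3))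
    simp only [sub_re] at h2' h3' hηc
    refine norm_eulerIntegrandFDeriv_le ht hη (by linarith) ?_ (hM₁ t (Ioo_subset_Icc_self ht))
      (hM₂ (p.1, t) ⟨by rwa [Metric.mem_closedBall, dist_eq_norm], Ioo_subset_Icc_self ht⟩)
    rw [sub_re]
    linarith
  · exact (ae_restrict_mem measurableSet_Ioo).mono fun t ht p _ => hasFDerivAt_eulerIntegrand hw ht p

end HobsonLegendre

namespace HobsonLegendre

open Complex Set Filter Topology

/-! ### Existence of the principal branch and its dependence on the parameters -/

/-- The contiguous relation builds the branch at `c` from those at `c + 1` and `c + 2`; `N` bounds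
the unit shifts needed to reach the range of Euler's integral. -/
theorem exists_isPrincipalGauss_of_nat (a : ℂ) {b : ℂ} (hb : 0 < b.re) (N : ℕ) :
    ∀ c : ℂ, 0 < (c - b).re + N → ∃ f, IsPrincipalGauss a b c f := by
  induction N with
  | zero => exact fun c hc => ⟨_, isPrincipalGauss_eulerIntegral hb (by simpa using hc)⟩
  | succ N ih =>
    intro c hc
    push_cast [sub_re] at hc
    obtain ⟨f, hf⟩ := ih (c + 1) (by simp only [sub_re, add_re, one_re]; linarith)
    obtain ⟨g, hg⟩ := ih (c + 1 + 1) (by simp only [sub_re, add_re, one_re]; linarith)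
    have := hf.sub_one hg
    rw [add_sub_cancel_right] at this
    exact ⟨_, this⟩

theorem isPrincipalGauss_gaussReg (a : ℂ) {b : ℂ} (hb : 0 < b.re) (c : ℂ) :
    IsPrincipalGauss a b c (gaussReg a b c) := by
  obtain ⟨N, hN⟩ := exists_nat_gt (-(c - b).re)
  obtain ⟨f, hf⟩ := exists_isPrincipalGauss_of_nat a hb N c (by linarith)
  exact hf.isPrincipalGauss_gaussReg

theorem eventually_re_pos {p₀ : ℂ × ℂ × ℂ} (hb : 0 < p₀.2.1.re) :
    ∀ᶠ p : ℂ × ℂ × ℂ in 𝓝 p₀, 0 < p.2.1.re :=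
  (isOpen_lt continuous_const (by fun_prop)).mem_nhds hb

/-- The same descent in `c`, applied to differentiability. Both the integral representation and the
contiguous relation hold for all parameters near `p₀`, so they can be differentiated there. -/
theorem differentiableAt_gaussReg_of_nat {w : ℂ} (hw : w ∈ hgPlane) (N : ℕ) :
    ∀ p₀ : ℂ × ℂ × ℂ, 0 < p₀.2.1.re → 0 < (p₀.2.2 - p₀.2.1).re + N →
      DifferentiableAt ℂ (fun p : ℂ × ℂ × ℂ => gaussReg p.1 p.2.1 p.2.2 w) p₀ := by
  induction N with
  | zero =>
    intro p₀ hb hcb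
    rw [Nat.cast_zero, add_zero] at hcb
    have hG : DifferentiableAt ℂ (fun p : ℂ × ℂ × ℂ => (Gamma p.2.1)⁻¹ * (Gamma (p.2.2 - p.2.1))⁻¹
        * eulerIntegral p.1 p.2.1 p.2.2 w) p₀ := by
      refine DifferentiableAt.mul (DifferentiableAt.mul ?_ ?_) (differentiableAt_eulerIntegral hw hb hcb)
      · exact differentiable_one_div_Gamma.differentiableAt.comp p₀
          (f := fun p : ℂ × ℂ × ℂ => p.2.1) (by fun_prop)
      · exact differentiable_one_div_Gamma.differentiableAt.comp p₀
          (f := fun p : ℂ × ℂ × ℂ => p.2.2 - p.2.1) (by fun_prop)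
    refine hG.congr_of_eventuallyEq ?_
    have h : ∀ᶠ p : ℂ × ℂ × ℂ in 𝓝 p₀, 0 < (p.2.2 - p.2.1).re :=
      (isOpen_lt continuous_const (by fun_prop)).mem_nhds hcb
    filter_upwards [h, eventually_re_pos hb] with p hp hp'
    rw [gaussReg_eqOn (isPrincipalGauss_eulerIntegral hp' hp) hw, mul_inv]
  | succ N ih =>
    intro p₀ hb hcb
    push_cast [sub_re] at hcb
    have h1 := ih (p₀.1, p₀.2.1, p₀.2.2 + 1) hb
      (by simp only [sub_re, add_re, one_re]; linarith)
    have h2 := ih (p₀.1, p₀.2.1, p₀.2.2 + 2) hb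
      (by simp only [sub_re, add_re, re_ofNat]; linarith)
    have h1' : DifferentiableAt ℂ (fun p : ℂ × ℂ × ℂ => gaussReg p.1 p.2.1 (p.2.2 + 1) w) p₀ :=
      h1.comp p₀ (f := fun p : ℂ × ℂ × ℂ => (p.1, p.2.1, p.2.2 + 1)) (by fun_prop)
    have h2' : DifferentiableAt ℂ (fun p : ℂ × ℂ × ℂ => gaussReg p.1 p.2.1 (p.2.2 + 2) w) p₀ :=
      h2.comp p₀ (f := fun p : ℂ × ℂ × ℂ => (p.1, p.2.1, p.2.2 + 2)) (by fun_prop)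
    have h3 : DifferentiableAt ℂ (fun p : ℂ × ℂ × ℂ =>
        ((p.2.2 - (2 * (p.2.2 + 1) - p.1 - p.2.1 - 1) * w) * gaussReg p.1 p.2.1 (p.2.2 + 1) w
          + (p.2.2 + 1 - p.1) * (p.2.2 + 1 - p.2.1) * w * gaussReg p.1 p.2.1 (p.2.2 + 2) w)
          * (1 - w)⁻¹) p₀ := by
      fun_prop
    refine h3.congr_of_eventuallyEq ?_
    filter_upwards [eventually_re_pos hb] with p hp
    have hf := isPrincipalGauss_gaussReg p.1 hp (p.2.2 + 1)
    have hg := isPrincipalGauss_gaussReg p.1 hp (p.2.2 + 1 + 1)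
    have h := hf.sub_one hg
    rw [add_sub_cancel_right, add_assoc, one_add_one_eq_two] at h
    exact (gaussReg_eqOn h hw).trans (div_eq_mul_inv _ _)

theorem differentiableAt_gaussReg {w : ℂ} (hw : w ∈ hgPlane) {p₀ : ℂ × ℂ × ℂ}
    (hb : 0 < p₀.2.1.re) :
    DifferentiableAt ℂ (fun p : ℂ × ℂ × ℂ => gaussReg p.1 p.2.1 p.2.2 w) p₀ := by
  obtain ⟨N, hN⟩ := exists_nat_gt (-(p₀.2.2 - p₀.2.1).re)
  exact differentiableAt_gaussReg_of_nat hw N p₀ hb (by linarith)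

end HobsonLegendre

namespace HobsonLegendre

open Complex PowerSeries

/-! ### Euler's transformation -/

/-- The hypergeometric operator on formal power series. -/
noncomputable def hgOp (a b c : ℂ) (S : PowerSeries ℂ) : PowerSeries ℂ :=
  X * (1 - X) * d⁄dX ℂ (d⁄dX ℂ S) + (C c - (C a + C b + 1) * X) * d⁄dX ℂ S - C a * C b * S

theorem coeff_X_mul_derivative (S : PowerSeries ℂ) (k : ℕ) :
    coeff k (X * d⁄dX ℂ S) = k * coeff k S := by
  cases k with
  | zero => simp
  | succ k => rw [coeff_succ_X_mul, coeff_derivative]; push_cast; ring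

theorem coeff_hgOp (a b c : ℂ) (S : PowerSeries ℂ) (k : ℕ) :
    coeff k (hgOp a b c S)
      = (k + 1) * (c + k) * coeff (k + 1) S - (a + k) * (b + k) * coeff k S := by
  -- With `θ = X d/dX`, which multiplies the `k`-th coefficient by `k`, the operator is `d/dX (θ + c
  -- - 1) - (θ + a)(θ + b)`, expanded here.
  have h : hgOp a b c S = d⁄dX ℂ (X * d⁄dX ℂ S) + C (c - 1) * d⁄dX ℂ S
      - X * d⁄dX ℂ (X * d⁄dX ℂ S) - C (a + b) * (X * d⁄dX ℂ S) - C (a * b) * S := by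
    simp only [hgOp, Derivation.leibniz, derivative_X, smul_eq_mul, map_sub, map_add, map_mul,
      map_one]
    ring
  rw [h, map_sub, map_sub, map_sub, map_add]
  simp only [coeff_C_mul, coeff_X_mul_derivative, coeff_derivative]
  push_cast
  ring

theorem hgOp_eq_zero_iff {a b c : ℂ} {S : PowerSeries ℂ} :
    hgOp a b c S = 0 ↔
      ∀ k : ℕ, (k + 1) * (c + k) * coeff (k + 1) S = (a + k) * (b + k) * coeff k S := by
  simp only [PowerSeries.ext_iff, coeff_hgOp, map_zero, sub_eq_zero]

/-- The formal power series of `(1 - X) ^ (-a)`. -/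
noncomputable def oneSubPowNeg (a : ℂ) : PowerSeries ℂ :=
  mk fun k => (ascPochhammer ℂ k).eval a / k.factorial

theorem one_sub_X_mul_derivative_oneSubPowNeg (a : ℂ) :
    (1 - X) * d⁄dX ℂ (oneSubPowNeg a) = C a * oneSubPowNeg a := by
  ext k
  have hk : ((k : ℂ) + 1) ≠ 0 := Nat.cast_add_one_ne_zero k
  have hf : (k.factorial : ℂ) ≠ 0 := Nat.cast_ne_zero.2 k.factorial_ne_zero
  rw [sub_mul, one_mul, map_sub, coeff_X_mul_derivative, coeff_derivative, coeff_C_mul]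
  simp only [oneSubPowNeg, coeff_mk, ascPochhammer_succ_eval, Nat.factorial_succ]
  push_cast
  field_simp
  ring

/-- For `B = (1 - X) ^ (c - a - b)`, the relations for `(1 - X) B'` and `(1 - X) B''` reduce `1 - X`
times the equation for `B G` to a multiple of the equation for `G`; the factor `1 - X` then cancels
in a domain. -/
theorem hgOp_oneSubPowNeg_mul {a b c : ℂ} {G : PowerSeries ℂ} (hG : hgOp (c - a) (c - b) c G = 0) :
    hgOp a b c (oneSubPowNeg (a + b - c) * G) = 0 := by
  have h1 := one_sub_X_mul_derivative_oneSubPowNeg (a + b - c)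
  have h2 : (1 - X) * d⁄dX ℂ (d⁄dX ℂ (oneSubPowNeg (a + b - c)))
      = (C (a + b - c) + 1) * d⁄dX ℂ (oneSubPowNeg (a + b - c)) := by
    have := congrArg (d⁄dX ℂ) h1
    simp only [Derivation.leibniz, smul_eq_mul, map_sub, derivative_X, derivative_C,
      Derivation.map_one_eq_zero] at this ⊢
    linear_combination this
  have hX : (1 - X : PowerSeries ℂ) ≠ 0 := by
    intro h
    have := congrArg (coeff 0) h
    simp at this
  refine (mul_eq_zero.1 (?_ : (1 - X : PowerSeries ℂ) * _ = 0)).resolve_left hX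
  generalize oneSubPowNeg (a + b - c) = B at *
  simp only [hgOp, Derivation.leibniz, smul_eq_mul, map_sub, map_add] at *
  linear_combination B * (1 - X) * hG + X * (1 - X) * G * h2 + (X * G * (C a + C b - C c + 1)
    + 2 * X * (1 - X) * d⁄dX ℂ G + (C c - (C a + C b + 1) * X) * G) * h1

theorem hasSum_coeff_mul {S T : PowerSeries ℂ} {w x y : ℂ}
    (hS : HasSum (fun k => coeff k S * w ^ k) x) (hT : HasSum (fun k => coeff k T * w ^ k) y) :
    HasSum (fun k => coeff k (S * T) * w ^ k) (x * y) := by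
  have hs := summable_norm_sum_mul_antidiagonal_of_summable_norm hS.summable.norm hT.summable.norm
  have he := tsum_mul_tsum_eq_tsum_sum_antidiagonal_of_summable_norm hS.summable.norm
    hT.summable.norm
  rw [hS.tsum_eq, hT.tsum_eq] at he
  rw [he]
  refine hs.of_norm.hasSum.congr_fun fun k => ?_
  rw [coeff_mul, Finset.sum_mul]
  refine Finset.sum_congr rfl fun p hp => ?_
  rw [← Finset.HasAntidiagonal.mem_antidiagonal.1 hp, pow_add]
  ring

/-- The regularized Gauss polynomial `₂F₁(-N, b; c; w) / Γ(c)`. -/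
noncomputable def gaussPoly (N : ℕ) (b c w : ℂ) : ℂ :=
  ∑ k ∈ Finset.range (N + 1), gaussCoeff (-N) b c k * w ^ k

theorem gaussCoeff_neg_nat_eq_zero {N k : ℕ} (h : N < k) (b c : ℂ) :
    gaussCoeff (-N) b c k = 0 := by
  simp [gaussCoeff, ascPochhammer_eval_neg_coe_nat_of_lt h]

theorem hasSum_gaussPoly (N : ℕ) (b c w : ℂ) :
    HasSum (fun k => gaussCoeff (-N) b c k * w ^ k) (gaussPoly N b c w) := by
  refine hasSum_sum_of_ne_finset_zero fun k hk => ?_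
  rw [gaussCoeff_neg_nat_eq_zero (by simpa [Nat.lt_succ_iff] using hk), zero_mul]

/-- Both series satisfy the same two-term recursion and start at `1 / Γ(c)`. The condition on `c`
keeps `c + k` nonzero, so the recursion determines all coefficients. -/
theorem isPrincipalGauss_euler_transform {N : ℕ} {b c : ℂ} (hc : ∀ k : ℕ, c ≠ -k) :
    IsPrincipalGauss (c - b) (c + N) c (fun w => (1 - w) ^ (b - c - N) * gaussPoly N b c w) := by
  refine isPrincipalGauss_of_hasSum ?_ fun w hw => ?_
  · intro w hw
    have h : AnalyticAt ℂ (fun w => (1 - w) ^ (b - c - N)) w :=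
      AnalyticAt.cpow (by fun_prop) (by fun_prop) hw
    refine h.mul ?_
    unfold gaussPoly
    fun_prop
  · have hB : HasSum (fun k => coeff k (oneSubPowNeg (c + N - b)) * w ^ k)
        ((1 - w) ^ (b - c - N)) := by
      have := hasSum_one_sub_cpow_neg (c + N - b) hw
      rw [show -(c + N - b) = b - c - N by ring] at this
      simpa [oneSubPowNeg] using this
    have hP : HasSum (fun k => coeff k (mk (gaussCoeff (-N) b c)) * w ^ k) (gaussPoly N b c w) := by
      simpa using hasSum_gaussPoly N b c w
    have hT := hasSum_coeff_mul hB hP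
    have hG : hgOp (c - (c - b)) (c - (c + N)) c (mk (gaussCoeff (-N) b c)) = 0 := by
      rw [hgOp_eq_zero_iff]
      intro k
      rw [coeff_mk, coeff_mk, gaussCoeff_succ_mul]
      ring
    have hO := hgOp_oneSubPowNeg_mul hG
    rw [show c - b + (c + N) - c = c + N - b by ring, hgOp_eq_zero_iff] at hO
    refine hT.congr_fun fun k => ?_
    congr 1
    induction k with
    | zero => simp [oneSubPowNeg, gaussCoeff, coeff_mul]
    | succ k ih =>
      have h0 : ((k : ℂ) + 1) * (c + k) ≠ 0 := mul_ne_zero (Nat.cast_add_one_ne_zero k)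
        fun h => hc k (eq_neg_of_add_eq_zero_left h)
      refine mul_left_cancel₀ h0 ?_
      rw [gaussCoeff_succ_mul, hO k, ih]

end HobsonLegendre

namespace HobsonLegendre

open Complex

/-! ### Reflection of the Gauss polynomials with `a + b + 1 = 2 c` -/

/-- The Gauss polynomial as a polynomial in its argument. -/
noncomputable def gaussPolynomial (N : ℕ) (b c : ℂ) : Polynomial ℂ :=
  ∑ k ∈ Finset.range (N + 1), Polynomial.monomial k (gaussCoeff (-N) b c k)

theorem eval_gaussPolynomial (N : ℕ) (b c w : ℂ) :
    (gaussPolynomial N b c).eval w = gaussPoly N b c w := by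
  simp [gaussPolynomial, gaussPoly, Polynomial.eval_finsetSum]

theorem coeff_gaussPolynomial (N : ℕ) (b c : ℂ) (k : ℕ) :
    (gaussPolynomial N b c).coeff k = gaussCoeff (-N) b c k := by
  simp only [gaussPolynomial, Polynomial.finsetSum_coeff, Polynomial.coeff_monomial,
    Finset.sum_ite_eq', Finset.mem_range]
  split_ifs with h
  · rfl
  · exact (gaussCoeff_neg_nat_eq_zero (by omega) b c).symm

theorem natDegree_gaussPolynomial_le (N : ℕ) (b c : ℂ) : (gaussPolynomial N b c).natDegree ≤ N :=
  Polynomial.natDegree_le_iff_coeff_eq_zero.2 fun k hk => by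
    rw [coeff_gaussPolynomial, gaussCoeff_neg_nat_eq_zero (by exact_mod_cast hk)]

-- Moves the recursion from power series to polynomials, where the substitution `X ↦ 1 - X` is
-- available.
open Polynomial in
theorem coeff_hg_polynomial (a b c : ℂ) (S : Polynomial ℂ) (k : ℕ) :
    (X * (1 - X) * derivative (derivative S) + (C c - (C a + C b + 1) * X) * derivative S
      - C a * C b * S).coeff k
      = (k + 1) * (c + k) * S.coeff (k + 1) - (a + k) * (b + k) * S.coeff k := by
  have h := coeff_hgOp a b c (S : PowerSeries ℂ) k
  rw [Polynomial.coeff_coe, Polynomial.coeff_coe] at h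
  rw [← h, ← Polynomial.coeff_coe]
  simp only [hgOp, PowerSeries.derivative_coe, coe_sub, coe_add, coe_mul, coe_X, coe_C, coe_one]

open Polynomial in
theorem coeff_comp_one_sub_X {p : Polynomial ℂ} {N : ℕ} (hp : p.natDegree ≤ N) :
    (p.comp (1 - X)).coeff N = (-1) ^ N * p.coeff N := by
  have hd : (1 - X : Polynomial ℂ).natDegree = 1 := by
    rw [natDegree_sub, natDegree_sub_eq_left_of_natDegree_lt] <;> simp
  have hl : (1 - X : Polynomial ℂ).leadingCoeff = -1 := by
    rw [leadingCoeff, hd]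
    simp [coeff_one]
  rcases hp.lt_or_eq with h | rfl
  · rw [coeff_eq_zero_of_natDegree_lt h, mul_zero]
    refine coeff_eq_zero_of_natDegree_lt ?_
    rwa [natDegree_comp, hd, mul_one]
  · have := coeff_comp_degree_mul_degree (p := p) (q := 1 - X) (by rw [hd]; exact one_ne_zero)
    rw [hd, hl, mul_one] at this
    rw [this, mul_comm, leadingCoeff]

-- Since `a + b + 1 = 2 c`, the equation is invariant under `X ↦ 1 - X`, so the difference `R` of
-- the two sides also solves it. Its coefficient at `N` vanishes, and the recursion read downwards
-- kills the rest, as `(k - N)(b + k) ≠ 0` for `k < N`. No restriction on `c` is needed, so `c = 1 -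
-- m` is allowed.
open Polynomial in
theorem gaussPolynomial_comp_one_sub_X {N : ℕ} {b c : ℂ} (hbc : b - N + 1 = 2 * c)
    (hb : ∀ k : ℕ, b ≠ -k) :
    (gaussPolynomial N b c).comp (1 - X) = C ((-1) ^ N) * gaussPolynomial N b c := by
  set Q := gaussPolynomial N b c with hQ
  set R := Q.comp (1 - X) - C ((-1) ^ N) * Q with hR
  have hQode : X * (1 - X) * derivative (derivative Q)
      + (C c - (C (-(N : ℂ)) + C b + 1) * X) * derivative Q - C (-(N : ℂ)) * C b * Q = 0 := by
    ext k
    rw [coeff_hg_polynomial, coeff_gaussPolynomial, coeff_gaussPolynomial, gaussCoeff_succ_mul]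
    simp
  have h2c : C (-(N : ℂ)) + C b + 1 = 2 * C c := by
    rw [← C_1, ← C_add, ← C_add, show (2 : Polynomial ℂ) = C 2 from rfl, ← C_mul, ← hbc]
    congr 1
    ring
  have hRode : X * (1 - X) * derivative (derivative R)
      + (C c - (C (-(N : ℂ)) + C b + 1) * X) * derivative R - C (-(N : ℂ)) * C b * R = 0 := by
    rw [h2c] at hQode ⊢
    have hQode' := congrArg (fun p => p.comp (1 - X)) hQode
    simp only [hR, derivative_sub, derivative_comp, derivative_C, derivative_mul, sub_comp,
      add_comp, mul_comp, X_comp, one_comp, C_comp, derivative_one, derivative_X, zero_comp,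
      ofNat_comp, derivative_zero, zero_mul, zero_add] at hQode' ⊢
    linear_combination hQode' - C ((-1) ^ N) * hQode
  have hrec : ∀ k : ℕ, (k + 1) * (c + k) * R.coeff (k + 1) = (-N + k) * (b + k) * R.coeff k := by
    intro k
    have := congrArg (fun p => p.coeff k) hRode
    simp only [coeff_hg_polynomial, coeff_zero] at this
    exact sub_eq_zero.1 this
  have hRN : R.coeff N = 0 := by
    rw [hR, coeff_sub, coeff_C_mul, coeff_comp_one_sub_X (natDegree_gaussPolynomial_le N b c),
      sub_self]
  have hlow : ∀ j ≤ N, R.coeff (N - j) = 0 := by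
    intro j
    induction j with
    | zero => exact fun _ => hRN
    | succ j ih =>
      intro hj
      have h := hrec (N - (j + 1))
      rw [show N - (j + 1) + 1 = N - j by omega, ih (by omega), mul_zero] at h
      refine (mul_eq_zero.1 h.symm).resolve_left (mul_ne_zero ?_ fun h0 => hb _
        (eq_neg_of_add_eq_zero_left h0))
      rw [Nat.cast_sub hj]
      push_cast
      intro h0
      exact Nat.cast_add_one_ne_zero (R := ℂ) j (by linear_combination -h0)
  have hR0 : R = 0 := by
    ext k
    rw [coeff_zero]
    rcases le_or_gt k N with h | h
    · simpa [Nat.sub_sub_self h] using hlow (N - k) (Nat.sub_le N k)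
    · have h1 := natDegree_gaussPolynomial_le N b c
      rw [hR, coeff_sub, coeff_C_mul, coeff_eq_zero_of_natDegree_lt,
        coeff_eq_zero_of_natDegree_lt (h1.trans_lt h), mul_zero, sub_zero]
      refine (natDegree_comp_le.trans ?_).trans_lt h
      have : (1 - X : Polynomial ℂ).natDegree ≤ 1 := by compute_degree
      nlinarith
  exact sub_eq_zero.1 hR0

theorem gaussPoly_one_sub {N : ℕ} {b c : ℂ} (hbc : b - N + 1 = 2 * c) (hb : ∀ k : ℕ, b ≠ -k)
    (w : ℂ) : gaussPoly N b c w = (-1) ^ N * gaussPoly N b c (1 - w) := by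
  have h := congrArg (fun p => p.eval (1 - w)) (gaussPolynomial_comp_one_sub_X hbc hb)
  simpa [eval_gaussPolynomial, Polynomial.eval_comp] using h

end HobsonLegendre

namespace HobsonLegendre

open Complex Filter Topology

/-! ### Derivatives of the coefficients -/

theorem ne_neg_nat_of_re_pos {s : ℂ} (hs : 0 < s.re) (k : ℕ) : s ≠ -k := by
  rintro rfl
  simp at hs
  linarith [k.cast_nonneg (α := ℝ)]

/-- Induction through `1 / Γ(s) = s / Γ(s + 1)`: at `-(j + 1)` the second factor vanishes, so its
derivative is just multiplied by `-(j + 1)`. -/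
theorem hasDerivAt_one_div_Gamma_neg_nat (j : ℕ) :
    HasDerivAt (fun s : ℂ => (Gamma s)⁻¹) ((-1) ^ j * j.factorial) (-j) := by
  induction j with
  | zero =>
    rw [funext one_div_Gamma_eq_self_mul_one_div_Gamma_add_one]
    have h := (hasDerivAt_id (0 : ℂ)).mul
      ((differentiable_one_div_Gamma.differentiableAt.comp (0 : ℂ)
        (f := fun s : ℂ => s + 1) (by fun_prop)).hasDerivAt)
    rw [Nat.cast_zero, neg_zero]
    exact h.congr_deriv (by simp)
  | succ j ih =>
    rw [funext one_div_Gamma_eq_self_mul_one_div_Gamma_add_one]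
    have e : (-((j + 1 : ℕ) : ℂ)) + 1 = -j := by push_cast; ring
    rw [← e] at ih
    have h := (hasDerivAt_id (-((j + 1 : ℕ) : ℂ))).mul (ih.comp_add_const _ _)
    refine h.congr_deriv ?_
    rw [e, Gamma_neg_nat_eq_zero, Nat.factorial_succ]
    push_cast
    simp only [id, inv_zero]
    ring

theorem hasDerivAt_Gamma {s : ℂ} (hs : 0 < s.re) :
    HasDerivAt Gamma (digamma s * Gamma s) s := by
  refine (differentiableAt_Gamma s (ne_neg_nat_of_re_pos hs)).hasDerivAt.congr_deriv ?_
  rw [digamma_def, logDeriv_apply, div_mul_cancel₀ _ (Gamma_ne_zero_of_re_pos hs)]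

theorem hasDerivAt_one_div_Gamma {s : ℂ} (hs : 0 < s.re) :
    HasDerivAt (fun s : ℂ => (Gamma s)⁻¹) (-digamma s * (Gamma s)⁻¹) s := by
  have h0 := Gamma_ne_zero_of_re_pos hs
  refine ((hasDerivAt_Gamma hs).inv h0).congr_deriv ?_
  field_simp

theorem hasDerivAt_ascPochhammer {b : ℂ} (hb : 0 < b.re) (k : ℕ) :
    HasDerivAt (fun b : ℂ => (ascPochhammer ℂ k).eval b)
      ((ascPochhammer ℂ k).eval b * (digamma (b + k) - digamma b)) b := by
  have hbk : 0 < (b + k).re := by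
    simp only [add_re, natCast_re]
    positivity
  have h := ((hasDerivAt_Gamma hbk).comp_add_const b (k : ℂ)).mul (hasDerivAt_one_div_Gamma hb)
  have he : (fun b : ℂ => (ascPochhammer ℂ k).eval b) =ᶠ[𝓝 b]
      fun b : ℂ => Gamma (b + k) * (Gamma b)⁻¹ := by
    filter_upwards [(isOpen_lt continuous_const continuous_re).mem_nhds hb] with x hx
    rw [← ascPochhammer_mul_Gamma hx, mul_inv_cancel_right₀ (Gamma_ne_zero_of_re_pos hx)]
  refine (h.congr_of_eventuallyEq he).congr_deriv ?_
  have h0 := Gamma_ne_zero_of_re_pos hb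
  rw [← ascPochhammer_mul_Gamma hb]
  field_simp
  ring

theorem ascPochhammer_eval_neg_nat {N k : ℕ} (hk : k ≤ N) :
    (ascPochhammer ℂ k).eval (-(N : ℂ)) = (-1) ^ k * (N.factorial / (N - k).factorial) := by
  rw [ascPochhammer_eval_neg_eq_descPochhammer, descPochhammer_eval_eq_descFactorial,
    ← Nat.factorial_mul_descFactorial hk]
  push_cast
  rw [mul_div_cancel_left₀ _ (Nat.cast_ne_zero.2 (Nat.factorial_ne_zero _))]

theorem ascPochhammer_eval_nat_add_one (d k : ℕ) :
    (ascPochhammer ℂ k).eval ((d : ℂ) + 1) = (k + d).factorial / d.factorial := by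
  have h := ascPochhammer_mul_Gamma (b := (d : ℂ) + 1) (by
    simp only [add_re, natCast_re, one_re]; positivity) k
  rw [eq_div_iff (Nat.cast_ne_zero.2 (Nat.factorial_ne_zero _)), ← Gamma_nat_eq_factorial, h,
    ← Gamma_nat_eq_factorial]
  push_cast
  ring_nf

/-- The polynomial part, free of `ψ(n - m + 1)`, of the derivative along `(ν, μ) = (n + ε, m - ε)`. -/
noncomputable def psiPoly (m n : ℕ) (w : ℂ) : ℂ :=
  -((-1) ^ m * ((n + m).factorial / (n - m).factorial) * ∑ k ∈ Finset.range m,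
      ((k + (n - m)).factorial * (m - k - 1).factorial / (k.factorial * (n + m - k).factorial) : ℂ)
        * w ^ k)
    + (n + m).factorial / (n - m).factorial * (-w) ^ m * ∑ k ∈ Finset.range (n + 1),
      ((k + n).factorial / (k.factorial * (k + m).factorial * (n - k).factorial) : ℂ)
        * (2 * digamma (k + n + 1) - digamma (k + 1)) * (-w) ^ k

/-- Keeping the derivative `δ` of `1 / Γ` abstract covers both its zeros and its regular points. -/
theorem hasDerivAt_gaussCoeff_line (a : ℂ) {b c δ : ℂ} {k : ℕ} (hb : 0 < b.re)
    (hG : HasDerivAt (fun s : ℂ => (Gamma s)⁻¹) δ (c + k)) :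
    HasDerivAt (fun ε : ℂ => gaussCoeff a (b + 2 * ε) (c + ε) k)
      ((ascPochhammer ℂ k).eval a / k.factorial * (ascPochhammer ℂ k).eval b
        * (2 * (digamma (b + k) - digamma b) * (Gamma (c + k))⁻¹ + δ)) 0 := by
  have hl : HasDerivAt (fun ε : ℂ => b + 2 * ε) 2 0 := by
    simpa using ((hasDerivAt_id (0 : ℂ)).const_mul 2).const_add b
  have hl' : HasDerivAt (fun ε : ℂ => c + ε + k) 1 0 :=
    ((hasDerivAt_id (0 : ℂ)).const_add c).add_const _
  have hP := (hasDerivAt_ascPochhammer hb k).comp_of_eq (0 : ℂ) hl (by simp)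
  have hQ := hG.comp_of_eq (0 : ℂ) hl' (by simp)
  have h := ((hP.const_mul ((ascPochhammer ℂ k).eval a)).mul hQ).div_const (k.factorial : ℂ)
  refine h.congr_deriv ?_
  simp only [Function.comp_apply, mul_zero, add_zero]
  ring

/-- Here `c + k = -(m - k - 1)` is a zero of `1 / Γ`, so no digamma term survives; the signs `(-1) ^
k` and `(-1) ^ (m - k - 1)` combine to `-(-1) ^ m`. -/
theorem hasDerivAt_gaussCoeff_of_lt {m n k : ℕ} (hmn : m ≤ n) (hk : k < m) :
    HasDerivAt (fun ε : ℂ => gaussCoeff (-(n + m : ℕ)) ((n : ℂ) - m + 1 + 2 * ε) (1 - m + ε) k)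
      (-((-1) ^ m * ((n + m).factorial / (n - m).factorial) * ((k + (n - m)).factorial
        * (m - k - 1).factorial / (k.factorial * (n + m - k).factorial)))) 0 := by
  obtain ⟨d, rfl⟩ := Nat.exists_eq_add_of_le hmn
  obtain ⟨j, rfl⟩ := Nat.exists_eq_add_of_lt hk
  have hb : (((k + j + 1 + d : ℕ) : ℂ) - (k + j + 1 : ℕ) + 1) = d + 1 := by push_cast; ring
  have hc : (1 - ((k + j + 1 : ℕ) : ℂ)) + k = -j := by push_cast; ring
  rw [hb]
  refine (hasDerivAt_gaussCoeff_line _ (by simp only [add_re, natCast_re, one_re]; positivity)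
    (hc ▸ hasDerivAt_one_div_Gamma_neg_nat j)).congr_deriv ?_
  rw [hc, Gamma_neg_nat_eq_zero, ascPochhammer_eval_neg_nat (by omega),
    ascPochhammer_eval_nat_add_one, show k + j + 1 + d - (k + j + 1) = d by omega,
    show k + j + 1 - k - 1 = j by omega]
  ring

/-- The part with `ψ(n - m + 1)` is proportional to the coefficient itself and is split off, so that
it sums to a multiple of the undifferentiated polynomial. -/
theorem hasDerivAt_gaussCoeff_add {m n k : ℕ} (hmn : m ≤ n) (hk : k ≤ n) :
    HasDerivAt
      (fun ε : ℂ => gaussCoeff (-(n + m : ℕ)) ((n : ℂ) - m + 1 + 2 * ε) (1 - m + ε) (m + k))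
      ((n + m).factorial / (n - m).factorial * (-1) ^ (m + k)
          * ((k + n).factorial / (k.factorial * (k + m).factorial * (n - k).factorial))
          * (2 * digamma (k + n + 1) - digamma (k + 1))
        - 2 * digamma ((n : ℂ) - m + 1)
          * gaussCoeff (-(n + m : ℕ)) ((n : ℂ) - m + 1) (1 - m) (m + k)) 0 := by
  have hb : (n : ℂ) - m + 1 = (n - m : ℕ) + 1 := by rw [Nat.cast_sub hmn]
  have hc : (1 - (m : ℂ)) + (m + k : ℕ) = k + 1 := by push_cast; ring
  have hre : ∀ d : ℕ, 0 < ((d : ℂ) + 1).re := fun d => by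
    simp only [add_re, natCast_re, one_re]
    positivity
  have hbk : ((n - m : ℕ) : ℂ) + 1 + (m + k : ℕ) = k + n + 1 := by
    push_cast [Nat.cast_sub hmn]
    ring
  rw [hb]
  refine (hasDerivAt_gaussCoeff_line _ (hre _)
    (hc ▸ hasDerivAt_one_div_Gamma (hre k))).congr_deriv ?_
  rw [gaussCoeff, hc, hbk, Gamma_nat_eq_factorial, ascPochhammer_eval_neg_nat (by omega),
    ascPochhammer_eval_nat_add_one, show n + m - (m + k) = n - k by omega,
    show m + k + (n - m) = k + n by omega, add_comm k m]
  ring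

theorem gaussCoeff_eq_zero_of_lt (a b : ℂ) {m k : ℕ} (hk : k < m) :
    gaussCoeff a b (1 - m) k = 0 := by
  obtain ⟨j, rfl⟩ := Nat.exists_eq_add_of_lt hk
  have : (1 - ((k + j + 1 : ℕ) : ℂ) + k) = -j := by push_cast; ring
  rw [gaussCoeff, this, Gamma_neg_nat_eq_zero, inv_zero, mul_zero, zero_div]

theorem hasDerivAt_gaussPoly {m n : ℕ} (hmn : m ≤ n) (w : ℂ) :
    HasDerivAt (fun ε : ℂ => gaussPoly (n + m) ((n : ℂ) - m + 1 + 2 * ε) (1 - m + ε) w)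
      (psiPoly m n w - 2 * digamma ((n : ℂ) - m + 1)
        * gaussPoly (n + m) ((n : ℂ) - m + 1) (1 - m) w) 0 := by
  have hr : ∀ b c : ℂ, gaussPoly (n + m) b c w
      = ∑ k ∈ Finset.range m, gaussCoeff (-(n + m : ℕ)) b c k * w ^ k
        + ∑ k ∈ Finset.range (n + 1), gaussCoeff (-(n + m : ℕ)) b c (m + k) * w ^ (m + k) := by
    intro b c
    rw [gaussPoly, show n + m + 1 = m + (n + 1) by omega, Finset.sum_range_add]
  simp only [hr]
  have h1 := HasDerivAt.fun_sum fun k (hk : k ∈ Finset.range m) =>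
    (hasDerivAt_gaussCoeff_of_lt hmn (Finset.mem_range.1 hk)).mul_const (w ^ k)
  have h2 := HasDerivAt.fun_sum fun k (hk : k ∈ Finset.range (n + 1)) =>
    (hasDerivAt_gaussCoeff_add hmn (Nat.lt_succ_iff.1 (Finset.mem_range.1 hk))).mul_const
      (w ^ (m + k))
  refine (h1.add h2).congr_deriv ?_
  rw [Finset.sum_eq_zero (s := Finset.range m)
    (f := fun k => gaussCoeff _ _ (1 - (m : ℂ)) k * w ^ k) fun k hk => by
      rw [gaussCoeff_eq_zero_of_lt _ _ (Finset.mem_range.1 hk), zero_mul], zero_add, psiPoly,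
    Finset.mul_sum, Finset.mul_sum, Finset.mul_sum, ← Finset.sum_neg_distrib, add_sub_assoc,
    ← Finset.sum_sub_distrib]
  congr 1
  · refine Finset.sum_congr rfl fun k _ => ?_
    ring
  · refine Finset.sum_congr rfl fun k _ => ?_
    rw [neg_pow w m, neg_pow w k]
    ring

/-- Differentiate the reflection identity at `ε = 0`; its value at `ε = 0` cancels the `ψ(n - m +
1)` terms. -/
theorem psiPoly_one_sub {m n : ℕ} (hmn : m ≤ n) (w : ℂ) :
    psiPoly m n w = (-1) ^ (n + m) * psiPoly m n (1 - w) := by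
  have hre : 0 < ((n : ℂ) - m + 1).re := by
    have : (m : ℝ) ≤ n := Nat.cast_le.2 hmn
    simp only [add_re, sub_re, natCast_re, one_re]
    linarith
  have hrefl : ∀ ε : ℂ, 0 < ((n : ℂ) - m + 1 + 2 * ε).re →
      gaussPoly (n + m) ((n : ℂ) - m + 1 + 2 * ε) (1 - m + ε) w
        = (-1) ^ (n + m) * gaussPoly (n + m) ((n : ℂ) - m + 1 + 2 * ε) (1 - m + ε) (1 - w) :=
    fun ε hε => gaussPoly_one_sub (by push_cast; ring) (ne_neg_nat_of_re_pos hε) w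
  have h0 := hrefl 0 (by simpa using hre)
  rw [mul_zero, add_zero, add_zero] at h0
  have h1 := hasDerivAt_gaussPoly hmn w
  have h2 := (hasDerivAt_gaussPoly hmn (1 - w)).const_mul ((-1) ^ (n + m))
  have he : (fun ε : ℂ => gaussPoly (n + m) ((n : ℂ) - m + 1 + 2 * ε) (1 - m + ε) w) =ᶠ[𝓝 0]
      fun ε => (-1) ^ (n + m) * gaussPoly (n + m) ((n : ℂ) - m + 1 + 2 * ε) (1 - m + ε) (1 - w) := by
    have hopen : IsOpen {ε : ℂ | 0 < ((n : ℂ) - m + 1 + 2 * ε).re} :=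
      isOpen_lt continuous_const (by fun_prop)
    filter_upwards [hopen.mem_nhds (by simpa using hre)] with ε hε
    exact hrefl ε hε
  have h3 := h1.unique (h2.congr_of_eventuallyEq he)
  linear_combination h3 + 2 * digamma ((n : ℂ) - m + 1) * h0

end HobsonLegendre

namespace HobsonLegendre

open Complex Filter Topology

/-! ### Phases on the cut plane -/

theorem add_one_mem_slitPlane {z : ℂ} (hz : z - 1 ∈ slitPlane) : z + 1 ∈ slitPlane := by
  rw [mem_slitPlane_iff] at hz ⊢
  rcases hz with h | h
  · left
    simp only [sub_re, one_re, add_re] at h ⊢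
    linarith
  · right
    simpa using h

theorem abs_arg_sub_arg_lt {u v : ℂ} (hu : u ∈ slitPlane) (hv : v ∈ slitPlane)
    (h : (0 < u.im ∧ 0 < v.im) ∨ (u.im < 0 ∧ v.im < 0) ∨ (u.im = 0 ∧ v.im = 0)) :
    |u.arg - v.arg| < Real.pi := by
  have hu' := mem_slitPlane_iff_arg.1 hu
  have hv' := mem_slitPlane_iff_arg.1 hv
  rcases h with ⟨h1, h2⟩ | ⟨h1, h2⟩ | ⟨h1, h2⟩
  · have := arg_nonneg_iff.2 h1.le
    have := arg_nonneg_iff.2 h2.le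
    have := (arg_le_pi u).lt_of_ne hu'.1
    have := (arg_le_pi v).lt_of_ne hv'.1
    rw [abs_lt]
    constructor <;> linarith
  · have := arg_neg_iff.2 h1
    have := arg_neg_iff.2 h2
    have := neg_pi_lt_arg u
    have := neg_pi_lt_arg v
    rw [abs_lt]
    constructor <;> linarith
  · have e1 : u.arg = 0 := arg_eq_zero_iff.2
      ⟨((mem_slitPlane_iff.1 hu).resolve_right (not_not.2 h1)).le, h1⟩
    have e2 : v.arg = 0 := arg_eq_zero_iff.2
      ⟨((mem_slitPlane_iff.1 hv).resolve_right (not_not.2 h2)).le, h2⟩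
    rw [e1, e2, sub_self, abs_zero]
    exact Real.pi_pos

theorem log_div_of_abs_arg_sub_lt {u v : ℂ} (hu : u ≠ 0) (hv : v ≠ 0)
    (h : |u.arg - v.arg| < Real.pi) : log (u / v) = log u - log v := by
  have e : exp (log u - log v) = u / v := by rw [exp_sub, exp_log hu, exp_log hv]
  rw [abs_lt] at h
  rw [← e, log_exp]
  · simpa [log_im] using h.1
  · simpa [log_im] using h.2.le

theorem div_two_mem_slitPlane {u : ℂ} (hu : u ∈ slitPlane) : u / 2 ∈ slitPlane := by
  rw [mem_slitPlane_iff] at hu ⊢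
  simpa using hu

/-- The numbers `z + 1` and `z - 1` have equal imaginary parts, so their arguments differ by less
than `π` and no `2πi` appears. -/
theorem log_half_div_half {z : ℂ} (hz : z - 1 ∈ slitPlane) :
    log ((z + 1) / (z - 1)) = log ((z + 1) / 2) - log ((z - 1) / 2) ∧
      log ((z - 1) / (z + 1)) = log ((z - 1) / 2) - log ((z + 1) / 2) := by
  have h1 := div_two_mem_slitPlane hz
  have h2 := div_two_mem_slitPlane (add_one_mem_slitPlane hz)
  have him : ((z + 1) / 2).im = ((z - 1) / 2).im := by simp
  have hs : |((z + 1) / 2).arg - ((z - 1) / 2).arg| < Real.pi := by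
    refine abs_arg_sub_arg_lt h2 h1 ?_
    rw [him]
    rcases lt_trichotomy ((z - 1) / 2).im 0 with h | h | h
    · exact Or.inr (Or.inl ⟨h, h⟩)
    · exact Or.inr (Or.inr ⟨h, h⟩)
    · exact Or.inl ⟨h, h⟩
  have e1 : (z + 1) / (z - 1) = ((z + 1) / 2) / ((z - 1) / 2) := by
    rw [div_div_div_cancel_right₀ two_ne_zero]
  have e2 : (z - 1) / (z + 1) = ((z - 1) / 2) / ((z + 1) / 2) := by
    rw [div_div_div_cancel_right₀ two_ne_zero]
  constructor
  · rw [e1, log_div_of_abs_arg_sub_lt (slitPlane_ne_zero h2) (slitPlane_ne_zero h1) hs]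
  · rw [e2, log_div_of_abs_arg_sub_lt (slitPlane_ne_zero h1) (slitPlane_ne_zero h2)
      (by rwa [abs_sub_comm])]

theorem cpow_mul_cpow_eq_powQuarter (m : ℕ) {z : ℂ} (hz : z - 1 ∈ slitPlane) :
    ((z + 1) / (z - 1)) ^ ((m : ℂ) / 2) * ((z + 1) / 2) ^ (-(m : ℂ))
      = powQuarter z (-((m : ℂ) / 2)) := by
  have h1 := slitPlane_ne_zero hz
  have h2 := slitPlane_ne_zero (add_one_mem_slitPlane hz)
  rw [powQuarter, cpow_def_of_ne_zero (div_ne_zero h2 h1), cpow_def_of_ne_zero (by simpa using h2),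
    cpow_def_of_ne_zero (by simpa using h1), cpow_def_of_ne_zero (by simpa using h2),
    (log_half_div_half hz).1, ← exp_add, ← exp_add]
  congr 1
  ring

theorem powQuarter_mul_pow (m : ℕ) {z : ℂ} (hz : z - 1 ∈ slitPlane) :
    powQuarter z (-((m : ℂ) / 2)) * ((z - 1) / 2) ^ m = ((z - 1) / (z + 1)) ^ ((m : ℂ) / 2) ∧
      powQuarter z (-((m : ℂ) / 2)) * ((z + 1) / 2) ^ m
        = ((z + 1) / (z - 1)) ^ ((m : ℂ) / 2) := by
  have h1 := slitPlane_ne_zero hz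
  have h2 := slitPlane_ne_zero (add_one_mem_slitPlane hz)
  have ha : (z - 1) / 2 ≠ 0 := by simpa using h1
  have hb : (z + 1) / 2 ≠ 0 := by simpa using h2
  constructor
  · rw [powQuarter, cpow_def_of_ne_zero (div_ne_zero h1 h2), ← cpow_natCast,
      cpow_def_of_ne_zero ha, cpow_def_of_ne_zero hb, cpow_def_of_ne_zero ha,
      (log_half_div_half hz).2, ← exp_add, ← exp_add]
    congr 1
    ring
  · rw [powQuarter, cpow_def_of_ne_zero (div_ne_zero h2 h1), ← cpow_natCast,
      cpow_def_of_ne_zero ha, cpow_def_of_ne_zero hb, cpow_def_of_ne_zero hb,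
      (log_half_div_half hz).1, ← exp_add, ← exp_add]
    congr 1
    ring

/-! ### The derivative along `(ν, μ) = (n + ε, m - ε)` -/

theorem one_sub_half {z : ℂ} : 1 - (1 - z) / 2 = (z + 1) / 2 := by ring

theorem mem_hgPlane_half {z : ℂ} (hz : z - 1 ∈ slitPlane) : (1 - z) / 2 ∈ hgPlane := by
  rw [hgPlane, Set.mem_ofPred_eq, one_sub_half]
  exact div_two_mem_slitPlane (add_one_mem_slitPlane hz)

theorem differentiableAt_legendreP {z : ℂ} (hz : z - 1 ∈ slitPlane) {p₀ : ℂ × ℂ}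
    (hν : 0 < (p₀.1 + 1).re) :
    DifferentiableAt ℂ (fun p : ℂ × ℂ => legendreP p.1 p.2 z) p₀ := by
  have hX : (z + 1) / (z - 1) ≠ 0 :=
    div_ne_zero (slitPlane_ne_zero (add_one_mem_slitPlane hz)) (slitPlane_ne_zero hz)
  refine DifferentiableAt.mul ?_ ?_
  · exact DifferentiableAt.const_cpow (by fun_prop) (Or.inl hX)
  · exact (differentiableAt_gaussReg (mem_hgPlane_half hz)
      (p₀ := (-p₀.1, p₀.1 + 1, 1 - p₀.2)) hν).comp p₀
      (f := fun p : ℂ × ℂ => (-p.1, p.1 + 1, 1 - p.2)) (by fun_prop)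

/-- Euler's transformation needs `1 - m + ε` to avoid the nonpositive integers. This holds for `0 <
|ε| < 1` but fails at `ε = 0` when `m ≥ 1`, hence the punctured neighbourhood. -/
theorem eventually_legendreP_eq {m n : ℕ} {z : ℂ} (hz : z - 1 ∈ slitPlane) :
    (fun ε : ℂ => legendreP (n + ε) (m - ε) z) =ᶠ[𝓝[≠] 0] fun ε =>
      ((z + 1) / (z - 1)) ^ (((m : ℂ) - ε) / 2) * (((z + 1) / 2) ^ (ε - m)
        * gaussPoly (n + m) ((n : ℂ) - m + 1 + 2 * ε) (1 - m + ε) ((1 - z) / 2)) := by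
  filter_upwards [inter_mem_nhdsWithin _ (Metric.ball_mem_nhds (0 : ℂ) one_pos)] with ε hε
  have hε0 : ε ≠ 0 := hε.1
  have hε1 : ‖ε‖ < 1 := by simpa using hε.2
  have hc : ∀ k : ℕ, 1 - (m : ℂ) + ε ≠ -k := by
    intro k hk
    have e : ε = ((m - 1 - k : ℤ) : ℂ) := by
      push_cast
      linear_combination hk
    rw [e, norm_intCast, ← Int.cast_abs] at hε1
    have hj : |(m - 1 - k : ℤ)| < 1 := by exact_mod_cast hε1
    rw [e, Int.abs_lt_one_iff.1 hj] at hε0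
    exact hε0 Int.cast_zero
  have h := isPrincipalGauss_euler_transform (N := n + m) (b := (n : ℂ) - m + 1 + 2 * ε) hc
  have e1 : 1 - (m : ℂ) + ε - ((n : ℂ) - m + 1 + 2 * ε) = -(n + ε) := by ring
  have e2 : 1 - (m : ℂ) + ε + (n + m : ℕ) = n + ε + 1 := by push_cast; ring
  have e3 : (n : ℂ) - m + 1 + 2 * ε - (1 - m + ε) - (n + m : ℕ) = ε - m := by push_cast; ring
  rw [e1, e2, e3] at h
  have h' := gaussReg_eqOn h (mem_hgPlane_half hz)
  simp only [one_sub_half] at h'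
  rw [legendreP, ← h', show 1 - ((m : ℂ) - ε) = 1 - m + ε by ring]

theorem hasDerivAt_const_cpow {x s : ℂ} {f : ℂ → ℂ} {f' : ℂ} (hx : x ≠ 0)
    (hf : HasDerivAt f f' s) : HasDerivAt (fun t => x ^ f t) (x ^ f s * log x * f') s :=
  hf.const_cpow (Or.inl hx)

/-- Both sides of the Euler form are continuous at `ε = 0`, so the equality extends there and the
product rule applies. The logarithms add up as `-1/2 (log ((z + 1) / 2) - log ((z - 1) / 2)) + log
((z + 1) / 2)`. -/
theorem hasDerivAt_legendreP_line {m n : ℕ} (hmn : m ≤ n) {z : ℂ} (hz : z - 1 ∈ slitPlane) :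
    HasDerivAt (fun ε : ℂ => legendreP (n + ε) (m - ε) z)
      (1 / 2 * legendreP n m z * logQuarter z
        - 2 * digamma ((n : ℂ) - m + 1) * legendreP n m z
        + powQuarter z (-((m : ℂ) / 2)) * psiPoly m n ((1 - z) / 2)) 0 := by
  have hX0 : (z + 1) / (z - 1) ≠ 0 :=
    div_ne_zero (slitPlane_ne_zero (add_one_mem_slitPlane hz)) (slitPlane_ne_zero hz)
  have ha := slitPlane_ne_zero (div_two_mem_slitPlane hz)
  have hb := slitPlane_ne_zero (div_two_mem_slitPlane (add_one_mem_slitPlane hz))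
  have hL : ContinuousAt (fun ε : ℂ => legendreP (n + ε) (m - ε) z) 0 :=
    ((differentiableAt_legendreP hz (p₀ := ((n : ℂ) + 0, (m : ℂ) - 0)) (by
      simp only [add_re, natCast_re, one_re, zero_re]; positivity)).comp (0 : ℂ)
        (f := fun ε : ℂ => ((n : ℂ) + ε, (m : ℂ) - ε)) (by fun_prop)).continuousAt
  have h1 : HasDerivAt (fun ε : ℂ => ((m : ℂ) - ε) / 2) (-1 / 2) 0 :=
    ((hasDerivAt_id (0 : ℂ)).const_sub _).div_const 2
  have h2 : HasDerivAt (fun ε : ℂ => ε - (m : ℂ)) 1 0 := (hasDerivAt_id (0 : ℂ)).sub_const _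
  have hR := (hasDerivAt_const_cpow hX0 h1).mul ((hasDerivAt_const_cpow hb h2).mul
    (hasDerivAt_gaussPoly hmn ((1 - z) / 2)))
  have hE := (hL.eventuallyEq_nhds_iff_eventuallyEq_nhdsNE hR.continuousAt).1
    (eventually_legendreP_eq hz)
  have h0 := hE.self_of_nhds
  refine (hR.congr_of_eventuallyEq hE).congr_deriv ?_
  simp only [Pi.mul_apply, mul_zero, add_zero, sub_zero, zero_sub] at h0 ⊢
  rw [h0, logQuarter, (log_half_div_half hz).1, ← cpow_mul_cpow_eq_powQuarter m hz]
  ring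

/-- For the total derivative `L`, linearity gives `L (1, 0) - L (0, 1) = L (1, -1)`. -/
theorem deriv_legendreP_sub_deriv_legendreP {m n : ℕ} (hmn : m ≤ n) {z : ℂ}
    (hz : z - 1 ∈ slitPlane) :
    DifferentiableAt ℂ (fun ν : ℂ => legendreP ν m z) n ∧
      DifferentiableAt ℂ (fun μ : ℂ => legendreP n μ z) m ∧
      deriv (fun ν : ℂ => legendreP ν m z) n - deriv (fun μ : ℂ => legendreP n μ z) m
        = 1 / 2 * legendreP n m z * logQuarter z
          - 2 * digamma ((n : ℂ) - m + 1) * legendreP n m z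
          + powQuarter z (-((m : ℂ) / 2)) * psiPoly m n ((1 - z) / 2) := by
  obtain ⟨L, hP⟩ : ∃ L, HasFDerivAt (fun p : ℂ × ℂ => legendreP p.1 p.2 z) L ((n : ℂ), (m : ℂ)) :=
    differentiableAt_legendreP hz (by simp only [add_re, natCast_re, one_re]; positivity)
  have h1 : HasDerivAt (fun ν : ℂ => legendreP ν m z) (L (1, 0)) n :=
    HasFDerivAt.comp_hasDerivAt (l := fun p : ℂ × ℂ => legendreP p.1 p.2 z)
      (f := fun ν : ℂ => (ν, (m : ℂ))) (n : ℂ) hP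
      ((hasDerivAt_id (n : ℂ)).prodMk (hasDerivAt_const (n : ℂ) (m : ℂ)))
  have h2 : HasDerivAt (fun μ : ℂ => legendreP n μ z) (L (0, 1)) m :=
    HasFDerivAt.comp_hasDerivAt (l := fun p : ℂ × ℂ => legendreP p.1 p.2 z)
      (f := fun μ : ℂ => ((n : ℂ), μ)) (m : ℂ) hP
      ((hasDerivAt_const (m : ℂ) (n : ℂ)).prodMk (hasDerivAt_id (m : ℂ)))
  have h3 : HasDerivAt (fun ε : ℂ => legendreP (n + ε) (m - ε) z) (L (1, -1)) 0 :=
    HasFDerivAt.comp_hasDerivAt_of_eq (l := fun p : ℂ × ℂ => legendreP p.1 p.2 z)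
      (f := fun ε : ℂ => ((n : ℂ) + ε, (m : ℂ) - ε)) (0 : ℂ) hP
      (((hasDerivAt_id (0 : ℂ)).const_add (n : ℂ)).prodMk
        ((hasDerivAt_id (0 : ℂ)).const_sub (m : ℂ))) (by simp)
  refine ⟨h1.differentiableAt, h2.differentiableAt, ?_⟩
  rw [h1.deriv, h2.deriv, ← h3.unique (hasDerivAt_legendreP_line hmn hz), ← map_sub]
  simp

end HobsonLegendre

/-! ### The two closed forms -/

theorem mainTheorem1 (m n : ℕ) (hmn : m ≤ n) (z : ℂ) (hz : z - 1 ∈ Complex.slitPlane) :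
    DifferentiableAt ℂ (fun ν : ℂ => HobsonLegendre.legendreP ν (m : ℂ) z) (n : ℂ) ∧
    DifferentiableAt ℂ (fun μ : ℂ => HobsonLegendre.legendreP (n : ℂ) μ z) (m : ℂ) ∧
    (deriv (fun ν : ℂ => HobsonLegendre.legendreP ν (m : ℂ) z) (n : ℂ)
        - deriv (fun μ : ℂ => HobsonLegendre.legendreP (n : ℂ) μ z) (m : ℂ)
      = 1 / 2 * HobsonLegendre.legendreP (n : ℂ) (m : ℂ) z * HobsonLegendre.logQuarter z
        - 2 * Complex.digamma ((n : ℂ) - (m : ℂ) + 1)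
            * HobsonLegendre.legendreP (n : ℂ) (m : ℂ) z
        - (-1 : ℂ) ^ m * (((n + m).factorial : ℂ) / ((n - m).factorial : ℂ))
            * HobsonLegendre.powQuarter z (-((m : ℂ) / 2))
            * ∑ k ∈ Finset.range m, (-1 : ℂ) ^ k
                * ((((k + (n - m)).factorial : ℂ) * ((m - k - 1).factorial : ℂ))
                  / ((k.factorial : ℂ) * ((n + m - k).factorial : ℂ)))
                * ((z - 1) / 2) ^ k
        + (((n + m).factorial : ℂ) / ((n - m).factorial : ℂ))
            * ((z - 1) / (z + 1)) ^ ((m : ℂ) / 2)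
            * ∑ k ∈ Finset.range (n + 1),
                (((k + n).factorial : ℂ)
                  / ((k.factorial : ℂ) * ((k + m).factorial : ℂ) * ((n - k).factorial : ℂ)))
                * (2 * Complex.digamma ((k : ℂ) + (n : ℂ) + 1) - Complex.digamma ((k : ℂ) + 1))
                * ((z - 1) / 2) ^ k) ∧
    (deriv (fun ν : ℂ => HobsonLegendre.legendreP ν (m : ℂ) z) (n : ℂ)
        - deriv (fun μ : ℂ => HobsonLegendre.legendreP (n : ℂ) μ z) (m : ℂ)
      = 1 / 2 * HobsonLegendre.legendreP (n : ℂ) (m : ℂ) z * HobsonLegendre.logQuarter z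
        - 2 * Complex.digamma ((n : ℂ) - (m : ℂ) + 1)
            * HobsonLegendre.legendreP (n : ℂ) (m : ℂ) z
        - (-1 : ℂ) ^ n * (((n + m).factorial : ℂ) / ((n - m).factorial : ℂ))
            * HobsonLegendre.powQuarter z (-((m : ℂ) / 2))
            * ∑ k ∈ Finset.range m,
                ((((k + (n - m)).factorial : ℂ) * ((m - k - 1).factorial : ℂ))
                  / ((k.factorial : ℂ) * ((n + m - k).factorial : ℂ)))
                * ((z + 1) / 2) ^ k
        + (-1 : ℂ) ^ n * (((n + m).factorial : ℂ) / ((n - m).factorial : ℂ))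
            * ((z + 1) / (z - 1)) ^ ((m : ℂ) / 2)
            * ∑ k ∈ Finset.range (n + 1), (-1 : ℂ) ^ k
                * (((k + n).factorial : ℂ)
                  / ((k.factorial : ℂ) * ((k + m).factorial : ℂ) * ((n - k).factorial : ℂ)))
                * (2 * Complex.digamma ((k : ℂ) + (n : ℂ) + 1) - Complex.digamma ((k : ℂ) + 1))
                * ((z + 1) / 2) ^ k) := by
  obtain ⟨h1, h2, h3⟩ := HobsonLegendre.deriv_legendreP_sub_deriv_legendreP hmn hz
  obtain ⟨hp1, hp2⟩ := HobsonLegendre.powQuarter_mul_pow m hz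
  refine ⟨h1, h2, ?_, ?_⟩
  · have hw : (1 - z) / 2 = -((z - 1) / 2) := by ring
    rw [h3, ← hp1, HobsonLegendre.psiPoly, hw, neg_neg,
      Finset.sum_congr rfl fun k _ => by rw [neg_pow ((z - 1) / 2) k, mul_left_comm, ← mul_assoc]]
    ring
  -- Turns the reflection sign `(-1) ^ (n + m)`, times the `(-1) ^ m` present in each part of
  -- `psiPoly`, into `(-1) ^ n`.
  · have hsq : ((-1 : ℂ) ^ m) * (-1) ^ m = 1 := by rw [← mul_pow]; simp
    rw [h3, ← hp2, HobsonLegendre.psiPoly_one_sub hmn, HobsonLegendre.one_sub_half,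
      HobsonLegendre.psiPoly]
    have hs := Finset.sum_congr (rfl : Finset.range (n + 1) = _) fun k _ =>
      show (((k + n).factorial : ℂ)
            / ((k.factorial : ℂ) * ((k + m).factorial : ℂ) * ((n - k).factorial : ℂ)))
          * (2 * Complex.digamma (k + n + 1) - Complex.digamma (k + 1)) * (-((z + 1) / 2)) ^ k
        = (-1) ^ k * (((k + n).factorial : ℂ)
            / ((k.factorial : ℂ) * ((k + m).factorial : ℂ) * ((n - k).factorial : ℂ)))
          * (2 * Complex.digamma (k + n + 1) - Complex.digamma (k + 1)) * ((z + 1) / 2) ^ k by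
        rw [neg_pow ((z + 1) / 2) k]
        ring
    rw [hs, neg_pow ((z + 1) / 2) m, pow_add]
    generalize Finset.sum (M := ℂ) (Finset.range m) _ = S
    generalize Finset.sum (M := ℂ) (Finset.range (n + 1)) _ = T
    generalize ((n + m).factorial : ℂ) / ((n - m).factorial : ℂ) = A
    generalize HobsonLegendre.powQuarter z (-((m : ℂ) / 2)) = q
    linear_combination ((-1) ^ n * A * q * (T * ((z + 1) / 2) ^ m - S)) * hsq
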